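/- Let $n\ge 2$, let $\Omega\subset\mathbb R^n$ be open and let $p\ge 2$. Write $A\Subset B$ if $\overline A$ is compact and contained in $B$. For $f:\Omega\times\mathbb R\to\mathbb R$ consider $$-\operatorname{div}\Big((|Du|-1)_+^{p-1}\frac{Du}{|Du|}\Big)=f(x,u)\quad\text{in }\Omega. \qquad (1)$$ With $H_{p-1}(\xi)=(|\xi|-1)_+^{p-1}\xi/|\xi|$ for $\xi\ne0$ and $H_{p-1}(0)=0$, a function $u\in W^{1,p}_{loc}(\Omega)$ is a local weak solution of (1) if for every open $\tilde\Omega\Subset\Omega$ and every $\varphi\in W^{1,p}_0(\tilde\Omega)$ one has $\int_\Omega\langle H_{p-1}(Du),D\varphi\rangle\,dx=\int_\Omega f(x,u)\varphi\,dx$ (both integrals being absolutely convergent). Assume that $f$ is positive on $\Omega\times\mathbb R$ and that for every open $U\Subset\Omega$ and every $K>0$ there are constants $L,M>0$ such that, for all $x,y\in U$ and $|s|,|r|\le K$, $$|f(x,s)-f(x,r)|\le L|s-r|\ \ (F1),\qquad |f(x,s)-f(y,s)|\le M|x-y|\ \ (F2).$$ Let $\gamma=0$ if $n=2$, and $\gamma<n-2$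 if $n\ge3$; suppose moreover that $\gamma\ge0$ or that $\Omega$ is bounded. Let $t\in[0,\frac{p-2}p]$, let $\Omega'\Subset\Omega$ be open, and let $u\in W^{1,\infty}_{loc}(\Omega)$ be a local weak solution of (1). Then: (a) For every open $\Omega''$ with $\Omega'\Subset\Omega''\Subset\Omega$, $$\sup_{x\in\Omega}\int_{\Omega'}\frac{1}{(|Du(y)|-1)_+^{pt}}\,\frac{1}{|x-y|^{\gamma}}\,dy\le C ,$$ where, for fixed $f$, the constant $C>0$ depends only on $n,p,t,\gamma,\Omega,\Omega',\Omega'',f$ and on an upper bound $K>0$ for $\|u\|_{W^{1,\infty}(\Omega'')}=\|u\|_{L^\infty(\Omega'')}+\|Du\|_{L^\infty(\Omega'')}$. More precisely, if (F1) and (F2) hold for $x,y\in\Omega''$ and $|s|,|r|\le K$ with constants $L,M>0$, and if $f(y,u(y))\ge c_1>0$ for a.e. $y\in\Omega''$, then $C$ can be chosen to depend only on $n,p,t,\gamma,\Omega,\Omega',\Omega'',K,L,M,c_1$ (and on no other property of $f$ or $u$). When $t=0$ the first factor of the integrand is read as $1$. (b) The set $\{x\in\Omega':|Du(x)|\le1\}$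 has Lebesgue measure zero. -/

import Mathlib

open MeasureTheory Set Filter Topology
open scoped ENNReal ContDiff

noncomputable section

namespace WidelyDegenerate

/-- The Euclidean space `ℝⁿ`. -/
abbrev Sp (n : ℕ) : Type := EuclideanSpace ℝ (Fin n)

/-- `U ⋐ Ω`: the closure of `U` is compact and contained in `Ω`. -/
def CompactlyIn {n : ℕ} (U Ω : Set (Sp n)) : Prop :=
  IsCompact (closure U) ∧ closure U ⊆ Ω

/-- `φ ∈ C_c^∞(U)`, extended by zero to the whole space. -/
def IsTestFun {n : ℕ} (U : Set (Sp n)) (φ : Sp n → ℝ) : Prop :=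
  ContDiff ℝ ∞ φ ∧ HasCompactSupport φ ∧ tsupport φ ⊆ U

/-- `Du` is the weak (distributional) gradient of `u` in the open set `Ω`. -/
def IsWeakGradient {n : ℕ} (Ω : Set (Sp n)) (u : Sp n → ℝ) (Du : Sp n → Sp n) : Prop :=
  LocallyIntegrableOn u Ω volume ∧ LocallyIntegrableOn Du Ω volume ∧
    ∀ φ : Sp n → ℝ, IsTestFun Ω φ → ∀ v : Sp n,
      ∫ x in Ω, u x * fderiv ℝ φ x v = -∫ x in Ω, φ x * inner ℝ (Du x) v

/-- `u ∈ W^{1,q}_loc(Ω)` with weak gradient `Du`. -/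
def MemW1loc {n : ℕ} (Ω : Set (Sp n)) (q : ℝ≥0∞) (u : Sp n → ℝ) (Du : Sp n → Sp n) : Prop :=
  IsWeakGradient Ω u Du ∧
    ∀ U : Set (Sp n), IsOpen U → CompactlyIn U Ω →
      MemLp u q (volume.restrict U) ∧ MemLp Du q (volume.restrict U)

/-- `φ ∈ W^{1,q}_0(U)` with gradient `Dφ`, both extended by zero outside `U`: the pair `(φ, Dφ)`
is the limit in `L^q` of pairs `(φ_k, ∇φ_k)` with `φ_k ∈ C_c^∞(U)`. -/
def MemW10 {n : ℕ} (U : Set (Sp n)) (q : ℝ≥0∞) (φ : Sp n → ℝ) (Dφ : Sp n → Sp n) : Prop :=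
  MemLp φ q volume ∧ MemLp Dφ q volume ∧
    ∃ φk : ℕ → Sp n → ℝ, (∀ k, IsTestFun U (φk k)) ∧
      Tendsto (fun k => eLpNorm (fun x => φk k x - φ x) q volume) atTop (𝓝 0) ∧
      Tendsto (fun k => eLpNorm (fun x => gradient (φk k) x - Dφ x) q volume) atTop (𝓝 0)

/-- The vector field `H_q(ξ) = (|ξ| - 1)_+^q ξ / |ξ|`, with `H_q(0) = 0`. -/
def H {n : ℕ} (q : ℝ) (ξ : Sp n) : Sp n :=
  if ξ = 0 then 0 else ((max (‖ξ‖ - 1) 0) ^ q / ‖ξ‖) • ξ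

/-- `u`, with weak gradient `Du`, is a local weak solution of
`-div ((|Du| - 1)_+^{p-1} Du / |Du|) = f(x, u)` in `Ω`. -/
def IsLocalWeakSolution {n : ℕ} (Ω : Set (Sp n)) (p : ℝ) (f : Sp n → ℝ → ℝ)
    (u : Sp n → ℝ) (Du : Sp n → Sp n) : Prop :=
  MemW1loc Ω (ENNReal.ofReal p) u Du ∧
    ∀ U : Set (Sp n), IsOpen U → CompactlyIn U Ω →
      ∀ (φ : Sp n → ℝ) (Dφ : Sp n → Sp n), MemW10 U (ENNReal.ofReal p) φ Dφ →
        IntegrableOn (fun x => inner ℝ (H (p - 1) (Du x)) (Dφ x)) Ω volume ∧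
        IntegrableOn (fun x => f x (u x) * φ x) Ω volume ∧
        ∫ x in Ω, inner ℝ (H (p - 1) (Du x)) (Dφ x) = ∫ x in Ω, f x (u x) * φ x

/-- The inequalities (F1) and (F2) on `U × [-K, K]` with constants `L` and `M`. -/
def LipBounds {n : ℕ} (f : Sp n → ℝ → ℝ) (U : Set (Sp n)) (K L M : ℝ) : Prop :=
  (∀ x ∈ U, ∀ s t : ℝ, |s| ≤ K → |t| ≤ K → |f x s - f x t| ≤ L * |s - t|) ∧
  (∀ x ∈ U, ∀ y ∈ U, ∀ s : ℝ, |s| ≤ K → |f x s - f y s| ≤ M * ‖x - y‖)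

/-- `f` satisfies (F1) and (F2): for all open `U ⋐ Ω` and `K > 0` there are such constants. -/
def SatisfiesF1F2 {n : ℕ} (f : Sp n → ℝ → ℝ) (Ω : Set (Sp n)) : Prop :=
  ∀ U : Set (Sp n), IsOpen U → CompactlyIn U Ω → ∀ K : ℝ, 0 < K →
    ∃ L M : ℝ, 0 < L ∧ 0 < M ∧ LipBounds f U K L M

/-- `f > 0` on `Ω × ℝ`. -/
def IsPositiveOn {n : ℕ} (f : Sp n → ℝ → ℝ) (Ω : Set (Sp n)) : Prop :=
  ∀ x ∈ Ω, ∀ s : ℝ, 0 < f x s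

/-- `‖u‖_{W^{1,∞}(U)} = ‖u‖_{L^∞(U)} + ‖Du‖_{L^∞(U)}`. -/
def normW1inf {n : ℕ} (U : Set (Sp n)) (u : Sp n → ℝ) (Du : Sp n → Sp n) : ℝ≥0∞ :=
  eLpNorm u ∞ (volume.restrict U) + eLpNorm Du ∞ (volume.restrict U)

/-- `sup_{x ∈ Ω} ∫_{Ω'} (|Du(y)| - 1)_+^{-pt} |x - y|^{-γ} dy`, with values in `[0, ∞]`; here
`ENNReal.ofReal (‖Du y‖ - 1)` is the positive part, and `0 ^ (-p t) = ∞` when `p t > 0`. -/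
def supWeightIntegral {n : ℕ} (Ω Ω' : Set (Sp n)) (p t γ : ℝ) (Du : Sp n → Sp n) : ℝ≥0∞ :=
  ⨆ x ∈ Ω, ∫⁻ y in Ω',
    ENNReal.ofReal (‖Du y‖ - 1) ^ (-(p * t)) * ENNReal.ofReal ‖x - y‖ ^ (-γ)

end WidelyDegenerate

end

/-! Put G = H_{p/2}(Du). Since H_{p-1} vanishes on the unit ball, Du itself has no second-order
regularity, but G does: H_{p-1} is monotone with |H_{p/2}(ξ) - H_{p/2}(ζ)|² ≤ c ⟨H_{p-1}(ξ) -
H_{p-1}(ζ), ξ - ζ⟩ (`norm_H_half_sub_sq_le`). Testing the differenced equation with ζ times an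
increment of u therefore gives a Caccioppoli estimate ∫ ζ |G(x+h) - G(x)|² ≤ C |h|²
(`integral_increment_sq_le`). The cross term is absorbed as soon as |Dζ|² ≤ ζ Θ, and C depends on ζ
only through a common bound B for ∫ ζ and ∫ Θ. This permits singular weights ζ = η² |x - y|^{-γ},
for which Θ behaves like |x - y|^{-γ-2}: this is the reason for γ < n - 2, and for γ = 0 that term
disappears.

Next, the equation is tested with ζ Ψ(G). As f ≥ c₁ > 0 and H_{p-1}(Du) is bounded, for every τ > 0
c₁ ∫ ζ Ψ(G) ≤ ∫ |Dζ| |H_{p-1}(Du)| Ψ(G) + nτ ∫ ζ |H_{p-1}(Du)|² |DΨ(G)|² + nC/(4τ), where the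
derivative of G has been paid for by the Caccioppoli estimate (`integral_testing_le`).

For (a), Ψ(g) = (κ + |g|²)^{-t}. Since |H_{p-1}| = |G|^{2(p-1)/p}, the factor |H_{p-1}|² |DΨ(G)|² is
at most a constant times Ψ(G) exactly when t ≤ (p-2)/p; for small τ the term goes to the left, with
a bound free of κ. Letting κ → 0 and using |G|^{-2t} = (|Du| - 1)_+^{-pt} gives the claim.

For (b), part (a) is of no use when p = 2, as then t = 0. Instead Ψ(g) = κ/(κ + |g|²), which tends
to the indicator of {g = 0}. Both terms carrying H_{p-1} vanish as κ → 0, so c₁ ∫ ζ 1_{G=0} ≤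
nC/(4τ) for every τ, and τ → ∞ shows that {G = 0} = {|Du| ≤ 1} is null.

All test functions are kept in C_c^∞ by mollifying u, Du and G; no weak derivative of G is ever
introduced. -/

noncomputable section

namespace WidelyDegenerate

/-! ### Inequalities for the power map a ↦ |a|^q a -/

section Algebra

variable {E : Type*} [NormedAddCommGroup E] [InnerProductSpace ℝ E]

/-- Bernoulli's inequality for s/r with exponent q + 1 ≥ 1. Raising the exponent by one covers 0 ≤ q
< 1 as well, where r ↦ r^q is not Lipschitz at 0. -/
lemma rpow_sub_rpow_mul_le {q r s : ℝ} (hq : 0 ≤ q) (hs : 0 ≤ s) (hsr : s ≤ r) :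
    (r ^ q - s ^ q) * r ≤ (q + 1) * r ^ q * (r - s) := by
  rcases hs.trans hsr |>.eq_or_lt with hr | hr
  · have : s = 0 := le_antisymm (hr ▸ hsr) hs
    simp [this, ← hr]
  have hx : -1 ≤ s / r - 1 := by
    have : 0 ≤ s / r := by positivity
    linarith
  have h1 := one_add_mul_self_le_rpow_one_add hx (p := q + 1) (by linarith)
  have h2 : (1 + (s / r - 1)) ^ (q + 1) * r ^ (q + 1) = s ^ (q + 1) := by
    rw [← Real.mul_rpow (by simpa using div_nonneg hs hr.le) hr.le]
    congr 1
    field_simp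
    ring
  have h3 : r ^ (q + 1) = r ^ q * r := by rw [Real.rpow_add hr, Real.rpow_one]
  have h4 : s ^ (q + 1) ≤ s ^ q * r := by
    rw [Real.rpow_add_one' hs (by linarith)]
    gcongr
  have h5 := mul_le_mul_of_nonneg_right h1 (Real.rpow_nonneg hr.le (q + 1))
  rw [h2] at h5
  have h6 : (1 + (q + 1) * (s / r - 1)) * r ^ (q + 1)
      = r ^ q * r - (q + 1) * r ^ q * (r - s) := by
    rw [h3]; field_simp; ring
  rw [h6] at h5
  linarith

lemma norm_rpow_smul_sub_le {q : ℝ} (hq : 0 ≤ q) (a b : E) :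
    ‖‖a‖ ^ q • a - ‖b‖ ^ q • b‖ ≤ (q + 2) * max ‖a‖ ‖b‖ ^ q * ‖a - b‖ := by
  wlog hab : ‖b‖ ≤ ‖a‖ generalizing a b
  · rw [norm_sub_rev, max_comm, norm_sub_rev a b]
    exact this b a (le_of_not_ge hab)
  rw [max_eq_left hab]
  have e : ‖a‖ ^ q • a - ‖b‖ ^ q • b = ‖b‖ ^ q • (a - b) + (‖a‖ ^ q - ‖b‖ ^ q) • a := by
    module
  have hmono : ‖b‖ ^ q ≤ ‖a‖ ^ q := by gcongr
  calc ‖‖a‖ ^ q • a - ‖b‖ ^ q • b‖ ≤ ‖b‖ ^ q * ‖a - b‖ + (‖a‖ ^ q - ‖b‖ ^ q) * ‖a‖ := by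
        rw [e]
        refine (norm_add_le _ _).trans (le_of_eq ?_)
        rw [norm_smul, norm_smul, Real.norm_of_nonneg (by positivity),
          Real.norm_of_nonneg (by linarith)]
    _ ≤ ‖a‖ ^ q * ‖a - b‖ + (q + 1) * ‖a‖ ^ q * ‖a - b‖ := by
        have h := rpow_sub_rpow_mul_le hq (norm_nonneg b) hab
        have h' : (q + 1) * ‖a‖ ^ q * (‖a‖ - ‖b‖) ≤ (q + 1) * ‖a‖ ^ q * ‖a - b‖ := by
          gcongr
          exact norm_sub_norm_le a b
        have h'' : ‖b‖ ^ q * ‖a - b‖ ≤ ‖a‖ ^ q * ‖a - b‖ := by gcongr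
        linarith
    _ = _ := by ring

/-- Twice the inner product equals (|a|^q + |b|^q)|a - b|² + (|a|^q - |b|^q)(|a|² - |b|²), and the
last two factors have the same sign. -/
lemma rpow_mul_norm_sub_sq_le_inner {q : ℝ} (hq : 0 ≤ q) (a b : E) :
    max ‖a‖ ‖b‖ ^ q * ‖a - b‖ ^ 2 ≤ 2 * inner ℝ (‖a‖ ^ q • a - ‖b‖ ^ q • b) (a - b) := by
  wlog hab : ‖b‖ ≤ ‖a‖ generalizing a b
  · have := this b a (le_of_not_ge hab)
    rw [max_comm, norm_sub_rev a b]
    refine this.trans (le_of_eq ?_)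
    rw [← neg_sub (‖a‖ ^ q • a), ← neg_sub a b, inner_neg_neg]
  rw [max_eq_left hab]
  have hmono : ‖b‖ ^ q ≤ ‖a‖ ^ q := by gcongr
  have hsq : ‖b‖ ^ 2 ≤ ‖a‖ ^ 2 := by gcongr
  have e : 2 * inner ℝ (‖a‖ ^ q • a - ‖b‖ ^ q • b) (a - b)
      = (‖a‖ ^ q + ‖b‖ ^ q) * ‖a - b‖ ^ 2 + (‖a‖ ^ q - ‖b‖ ^ q) * (‖a‖ ^ 2 - ‖b‖ ^ 2) := by
    rw [norm_sub_sq_real, inner_sub_left, inner_sub_right, inner_sub_right]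
    simp only [real_inner_smul_left, real_inner_self_eq_norm_sq, real_inner_comm a b]
    ring
  rw [e]
  have h1 : 0 ≤ ‖b‖ ^ q * ‖a - b‖ ^ 2 := by positivity
  have h2 := mul_nonneg (sub_nonneg.2 hmono) (sub_nonneg.2 hsq)
  linarith

end Algebra

/-! ### Monotonicity and growth of the degenerate field -/

section FieldH

variable {n : ℕ}

lemma norm_H {q : ℝ} (hq : q ≠ 0) (ξ : Sp n) : ‖H q ξ‖ = max (‖ξ‖ - 1) 0 ^ q := by
  unfold H
  split_ifs with h
  · simp [h, Real.zero_rpow hq]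
  · rw [norm_smul, Real.norm_of_nonneg (by positivity)]
    have := norm_ne_zero_iff.2 h
    field_simp

/-- Each field is a power map applied to H_1, so the degenerate inequalities follow from those for
|a|^q a together with the geometry of H_1. -/
lemma H_eq_smul_H_one {q : ℝ} (hq : 1 ≤ q) (ξ : Sp n) :
    H q ξ = ‖H 1 ξ‖ ^ (q - 1) • H 1 ξ := by
  rw [norm_H one_ne_zero, Real.rpow_one]
  unfold H
  split_ifs with h
  · simp
  · rw [smul_smul]
    congr 1
    rw [Real.rpow_one, mul_div_assoc']
    congr 1
    rw [← Real.rpow_add_one' (le_max_right _ _) (by linarith)]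
    congr 1; ring

lemma H_one_of_norm_le {ξ : Sp n} (h : ‖ξ‖ ≤ 1) : H 1 ξ = 0 := by
  rw [← norm_eq_zero, norm_H one_ne_zero, Real.rpow_one]
  exact max_eq_right (by linarith)

lemma norm_sub_H_one_le (ξ : Sp n) : ‖ξ - H 1 ξ‖ ≤ 1 := by
  rcases le_total ‖ξ‖ 1 with h | h
  · simpa [H_one_of_norm_le h] using h
  · have h0 : ξ ≠ 0 := by rintro rfl; simp at h; linarith
    have h1 := norm_ne_zero_iff.2 h0
    have : ξ - H 1 ξ = (1 / ‖ξ‖) • ξ := by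
      simp only [H, h0, if_false, Real.rpow_one]
      rw [max_eq_left (by linarith)]
      nth_rw 1 [← one_smul ℝ ξ]
      rw [← sub_smul]
      congr 1
      field_simp
      ring
    rw [this, norm_smul, norm_div, norm_norm, norm_one]
    field_simp; rfl

lemma norm_H_one_le_inner (ξ : Sp n) : ‖H 1 ξ‖ ≤ inner ℝ (H 1 ξ) (ξ - H 1 ξ) := by
  rcases le_total ‖ξ‖ 1 with h | h
  · simp [H_one_of_norm_le h]
  · have h0 : ξ ≠ 0 := by rintro rfl; simp at h; linarith
    have h1 := norm_ne_zero_iff.2 h0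
    rw [inner_sub_right, real_inner_self_eq_norm_sq, norm_H one_ne_zero, Real.rpow_one]
    simp only [H, h0, if_false, Real.rpow_one]
    rw [max_eq_left (by linarith), real_inner_smul_left, real_inner_self_eq_norm_sq]
    apply le_of_eq
    field_simp
    ring

/-- ξ - H_1(ξ) is the projection of ξ onto the closed unit ball and H_1(ξ) is an outer normal there:
this is the variational inequality of the projection. -/
lemma inner_H_one_sub_nonneg (ξ ζ : Sp n) :
    0 ≤ inner ℝ (H 1 ξ) ((ξ - H 1 ξ) - (ζ - H 1 ζ)) := by
  rw [inner_sub_right]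
  have h1 := norm_H_one_le_inner ξ
  have h2 := real_inner_le_norm (H 1 ξ) (ζ - H 1 ζ)
  have h3 := mul_le_mul_of_nonneg_left (norm_sub_H_one_le ζ) (norm_nonneg (H 1 ξ))
  linarith

/-- H_q is a nonnegative multiple of H_1, so the projected parts of ξ and ζ contribute with a good
sign and may be dropped. -/
lemma inner_H_sub_H_one_le {q : ℝ} (hq : 1 ≤ q) (ξ ζ : Sp n) :
    inner ℝ (H q ξ - H q ζ) (H 1 ξ - H 1 ζ) ≤ inner ℝ (H q ξ - H q ζ) (ξ - ζ) := by
  have e : ξ - ζ = (H 1 ξ - H 1 ζ) + ((ξ - H 1 ξ) - (ζ - H 1 ζ)) := by abel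
  rw [e, inner_add_right]
  have h1 := mul_nonneg (Real.rpow_nonneg (norm_nonneg (H 1 ξ)) (q - 1))
    (inner_H_one_sub_nonneg ξ ζ)
  have h2 := mul_nonneg (Real.rpow_nonneg (norm_nonneg (H 1 ζ)) (q - 1))
    (inner_H_one_sub_nonneg ζ ξ)
  rw [← real_inner_smul_left, ← H_eq_smul_H_one hq] at h1 h2
  rw [← neg_sub (ξ - H 1 ξ), inner_neg_right] at h2
  rw [inner_sub_left (H q ξ) (H q ζ) (ξ - H 1 ξ - (ζ - H 1 ζ))]
  linarith

/-- With a = H_1(ξ), b = H_1(ζ) and m = max(|a|, |b|), the left side is at most a constant times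
m^{p-2}|a - b|², and monotonicity of the power p - 2 controls precisely this quantity. -/
lemma norm_H_half_sub_sq_le {p : ℝ} (hp : 2 ≤ p) (ξ ζ : Sp n) :
    ‖H (p / 2) ξ - H (p / 2) ζ‖ ^ 2 ≤
      2 * (p / 2 + 1) ^ 2 * inner ℝ (H (p - 1) ξ - H (p - 1) ζ) (ξ - ζ) := by
  have h1 := norm_rpow_smul_sub_le (q := p / 2 - 1) (by linarith) (H 1 ξ) (H 1 ζ)
  rw [← H_eq_smul_H_one (by linarith), ← H_eq_smul_H_one (by linarith)] at h1
  have h2 := rpow_mul_norm_sub_sq_le_inner (q := p - 1 - 1) (by linarith) (H 1 ξ) (H 1 ζ)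
  rw [← H_eq_smul_H_one (by linarith), ← H_eq_smul_H_one (by linarith)] at h2
  have h3 := inner_H_sub_H_one_le (q := p - 1) (by linarith) ξ ζ
  set m := max ‖H 1 ξ‖ ‖H 1 ζ‖
  have hm : 0 ≤ m := le_max_of_le_left (norm_nonneg _)
  have h4 : (m ^ (p / 2 - 1)) ^ 2 = m ^ (p - 1 - 1) := by
    rw [← Real.rpow_natCast, ← Real.rpow_mul hm]
    congr 1; push_cast; ring
  calc ‖H (p / 2) ξ - H (p / 2) ζ‖ ^ 2
      ≤ ((p / 2 - 1 + 2) * m ^ (p / 2 - 1) * ‖H 1 ξ - H 1 ζ‖) ^ 2 := by gcongr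
    _ = (p / 2 + 1) ^ 2 * (m ^ (p - 1 - 1) * ‖H 1 ξ - H 1 ζ‖ ^ 2) := by
        rw [mul_pow, mul_pow, h4]; ring
    _ ≤ (p / 2 + 1) ^ 2 * (2 * inner ℝ (H (p - 1) ξ - H (p - 1) ζ) (ξ - ζ)) := by
        exact mul_le_mul_of_nonneg_left (by linarith) (sq_nonneg _)
    _ = _ := by ring

lemma H_eq_smul_H_half {p : ℝ} (hp : 2 ≤ p) (ξ : Sp n) :
    H (p - 1) ξ = ‖H (p / 2) ξ‖ ^ ((p - 2) / p) • H (p / 2) ξ := by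
  rw [norm_H (q := p / 2) (by linarith), H_eq_smul_H_one (q := p - 1) (by linarith),
    H_eq_smul_H_one (q := p / 2) (by linarith), smul_smul, norm_H one_ne_zero, Real.rpow_one]
  congr 1
  set w := max (‖ξ‖ - 1) 0
  have hw : 0 ≤ w := le_max_right _ _
  rw [← Real.rpow_mul hw, ← Real.rpow_add_of_nonneg hw]
  · congr 1; field_simp; ring
  · have : 0 ≤ (p - 2) / p := div_nonneg (by linarith) (by linarith)
    positivity
  · linarith

lemma norm_H_le_rpow {q K : ℝ} (hq : 0 < q) {ξ : Sp n} (h : ‖ξ‖ ≤ K) : ‖H q ξ‖ ≤ K ^ q := by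
  rw [norm_H hq.ne']
  have hK : 0 ≤ K := (norm_nonneg _).trans h
  exact Real.rpow_le_rpow (le_max_right _ _) (max_le (by linarith) hK) hq.le

/-- H_{p-1} is a power map of exponent (p-2)/p ≥ 0 applied to H_{p/2}, hence Lipschitz in H_{p/2} on
bounded gradients. This lets the cross term of the Caccioppoli estimate be absorbed. -/
lemma norm_H_sub_le {p K : ℝ} (hp : 2 ≤ p) {ξ ζ : Sp n} (hξ : ‖ξ‖ ≤ K) (hζ : ‖ζ‖ ≤ K) :
    ‖H (p - 1) ξ - H (p - 1) ζ‖ ≤ 3 * (K ^ (p / 2)) ^ ((p - 2) / p) *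
      ‖H (p / 2) ξ - H (p / 2) ζ‖ := by
  have hq : 0 ≤ (p - 2) / p := div_nonneg (by linarith) (by linarith)
  have hq' : (p - 2) / p ≤ 1 := by rw [div_le_one (by linarith)]; linarith
  have h1 := norm_rpow_smul_sub_le hq (H (p / 2) ξ) (H (p / 2) ζ)
  rw [← H_eq_smul_H_half hp, ← H_eq_smul_H_half hp] at h1
  refine h1.trans ?_
  have := norm_H_le_rpow (q := p / 2) (by linarith) hξ
  have := norm_H_le_rpow (q := p / 2) (by linarith) hζ
  gcongr
  · linarith
  · exact max_le ‹_› ‹_›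

lemma measurable_H (q : ℝ) : Measurable (H q : Sp n → Sp n) := by
  unfold H
  refine Measurable.ite (measurableSet_singleton 0) measurable_const ?_
  fun_prop

end FieldH

/-! ### Mollification of bounded measurable functions -/

section Mollifier

lemma locallyIntegrable_of_bounded {n : ℕ} {E' : Type*} [NormedAddCommGroup E'] [MeasurableSpace E']
    [BorelSpace E'] [SecondCountableTopology E'] {g : Sp n → E'} {K : ℝ} (hg : Measurable g) (hK : ∀ x, ‖g x‖ ≤ K) :
    LocallyIntegrable g volume := by
  refine (locallyIntegrable_const K).mono hg.aestronglyMeasurable (Eventually.of_forall fun x => ?_)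
  exact (hK x).trans (le_abs_self K)

variable {n : ℕ} {E' : Type*} [NormedAddCommGroup E'] [NormedSpace ℝ E']

/-- The radius of the `k`-th mollifier. -/
def molRadius (k : ℕ) : ℝ := 1 / ((k : ℝ) + 1)

lemma molRadius_pos (k : ℕ) : 0 < molRadius k := by unfold molRadius; positivity

lemma tendsto_molRadius : Tendsto molRadius atTop (𝓝 0) :=
  tendsto_one_div_add_atTop_nhds_zero_nat

/-- The bump function generating the `k`-th mollifier. -/
def molBump (n k : ℕ) : ContDiffBump (0 : Sp n) where
  rIn := molRadius k / 2
  rOut := molRadius k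
  rIn_pos := half_pos (molRadius_pos k)
  rIn_lt_rOut := half_lt_self (molRadius_pos k)

/-- The `k`-th standard mollifier. -/
def molKernel (k : ℕ) : Sp n → ℝ := (molBump n k).normed volume

/-- The mollification of `g` by the `k`-th mollifier. -/
def mollify (k : ℕ) (g : Sp n → E') : Sp n → E' :=
  convolution (molKernel k) g (ContinuousLinearMap.lsmul ℝ ℝ) volume

lemma mollify_apply (k : ℕ) (g : Sp n → E') (x : Sp n) :
    mollify k g x = ∫ z, molKernel k z • g (x - z) := rfl

lemma molKernel_nonneg (k : ℕ) (x : Sp n) : 0 ≤ molKernel k x := (molBump n k).nonneg_normed x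

lemma contDiff_molKernel (k : ℕ) : ContDiff ℝ ∞ (molKernel k : Sp n → ℝ) :=
  (molBump n k).contDiff_normed

lemma hasCompactSupport_molKernel (k : ℕ) : HasCompactSupport (molKernel k : Sp n → ℝ) :=
  (molBump n k).hasCompactSupport_normed

lemma tsupport_molKernel (k : ℕ) :
    tsupport (molKernel k : Sp n → ℝ) = Metric.closedBall 0 (molRadius k) :=
  (molBump n k).tsupport_normed_eq

lemma integral_molKernel (k : ℕ) : ∫ x : Sp n, molKernel k x = 1 := (molBump n k).integral_normed

lemma integrable_molKernel (k : ℕ) : Integrable (molKernel k : Sp n → ℝ) :=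
  (molBump n k).integrable_normed

lemma measurable_molKernel (k : ℕ) : Measurable (molKernel k : Sp n → ℝ) :=
  (contDiff_molKernel k).continuous.measurable

lemma norm_mollify_le {g : Sp n → E'} {K : ℝ} (k : ℕ) (hK : ∀ x, ‖g x‖ ≤ K) (x : Sp n) : ‖mollify k g x‖ ≤ K := by
  rw [mollify_apply]
  refine (norm_integral_le_of_norm_le ((integrable_molKernel k).mul_const K)
    (Eventually.of_forall fun z => ?_)).trans_eq ?_
  · rw [norm_smul, Real.norm_of_nonneg (molKernel_nonneg k z)]
    exact mul_le_mul_of_nonneg_left (hK _) (molKernel_nonneg k z)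
  · rw [integral_mul_const, integral_molKernel, one_mul]

variable [MeasurableSpace E'] [BorelSpace E'] [SecondCountableTopology E']
  {g : Sp n → E'} {K : ℝ}

lemma integrable_molKernel_smul (k : ℕ) (hg : Measurable g) (hK : ∀ x, ‖g x‖ ≤ K) (x : Sp n) :
    Integrable (fun z => molKernel k z • g (x - z)) := by
  refine ((integrable_molKernel k).mul_const K).mono' ?_ (Eventually.of_forall fun z => ?_)
  · exact ((measurable_molKernel k).smul (hg.comp (measurable_const.sub measurable_id)))
      |>.aestronglyMeasurable
  · rw [norm_smul, Real.norm_of_nonneg (molKernel_nonneg k z)]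
    exact mul_le_mul_of_nonneg_left (hK _) (molKernel_nonneg k z)

lemma contDiff_mollify (k : ℕ) (hg : Measurable g) (hK : ∀ x, ‖g x‖ ≤ K) :
    ContDiff ℝ ∞ (mollify k g) :=
  (hasCompactSupport_molKernel k).contDiff_convolution_left _ (contDiff_molKernel k)
    (locallyIntegrable_of_bounded hg hK)

lemma ae_tendsto_mollify [CompleteSpace E'] (hg : Measurable g) (hK : ∀ x, ‖g x‖ ≤ K) :
    ∀ᵐ x, Tendsto (fun k => mollify k g x) atTop (𝓝 (g x)) := by
  -- The constant 2 bounds the ratio of outer to inner radius of the bumps.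
  refine ContDiffBump.ae_convolution_tendsto_right_of_locallyIntegrable (K := 2)
    (φ := molBump n) tendsto_molRadius (Eventually.of_forall fun k => ?_)
    (locallyIntegrable_of_bounded hg hK)
  change molRadius k ≤ 2 * (molRadius k / 2)
  linarith

lemma mollify_add_sub (k : ℕ) (hg : Measurable g) (hK : ∀ x, ‖g x‖ ≤ K) (x h : Sp n) :
    mollify k g (x + h) - mollify k g x =
      ∫ z, molKernel k z • (g (x - z + h) - g (x - z)) := by
  simp only [mollify_apply, smul_sub]
  rw [integral_sub _ (integrable_molKernel_smul k hg hK x)]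
  · simp only [sub_add_eq_add_sub]
  · simpa only [sub_add_eq_add_sub] using integrable_molKernel_smul k hg hK (x + h)

/-- The kernel y ↦ ρ_k(x - y) is itself a test function in the definition of the weak gradient,
provided its support, the closed ball about x, lies in W. -/
lemma fderiv_mollify_apply {W : Set (Sp n)} {u : Sp n → ℝ} {D : Sp n → Sp n} {K : ℝ}
    (hu : Measurable u) (huK : ∀ x, ‖u x‖ ≤ K) (hD : Measurable D) (hDK : ∀ x, ‖D x‖ ≤ K)
    (hw : ∀ φ : Sp n → ℝ, IsTestFun W φ → ∀ v, ∫ x, u x * fderiv ℝ φ x v =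
      -∫ x, φ x * inner ℝ (D x) v)
    (k : ℕ) {x : Sp n} (hx : Metric.closedBall x (molRadius k) ⊆ W) (v : Sp n) :
    fderiv ℝ (mollify k u) x v = inner ℝ (mollify k D x) v := by
  have hloc := locallyIntegrable_of_bounded hu huK
  have hc1 : ContDiff ℝ 1 (molKernel k : Sp n → ℝ) := (contDiff_molKernel k).of_le (by simp)
  have h1 := (hasCompactSupport_molKernel k).hasFDerivAt_convolution_left
    (ContinuousLinearMap.lsmul ℝ ℝ) hc1 hloc x
  change HasFDerivAt (mollify k u) _ x at h1
  have hex : Integrable (fun t => (ContinuousLinearMap.precompL (Sp n)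
      (ContinuousLinearMap.lsmul ℝ ℝ)) (fderiv ℝ (molKernel k : Sp n → ℝ) t) (u (x - t))) :=
    ((hasCompactSupport_molKernel k).fderiv ℝ).convolutionExists_left _
      (hc1.continuous_fderiv one_ne_zero) hloc x
  rw [h1.fderiv, convolution_def, ContinuousLinearMap.integral_apply hex,
    ← integral_sub_left_eq_self _ _ x]
  have htest : IsTestFun W (fun y => molKernel k (x - y)) := by
    refine ⟨(contDiff_molKernel k).comp (contDiff_const.sub contDiff_id), ?_, ?_⟩
    · exact (hasCompactSupport_molKernel k).comp_homeomorph (Homeomorph.subLeft x)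
    · refine Subset.trans ?_ hx
      refine (tsupport_comp_subset_preimage (molKernel k) (f := fun y => x - y)
        (by fun_prop)).trans ?_
      rw [tsupport_molKernel]
      intro y hy
      simpa [dist_eq_norm, norm_sub_rev] using hy
  have hfd : ∀ y, fderiv ℝ (fun y => molKernel k (x - y)) y v = -fderiv ℝ (molKernel k) (x - y) v := by
    intro y
    have := ((hc1.differentiable one_ne_zero (x - y)).hasFDerivAt.comp y
      ((hasFDerivAt_id y).const_sub x)).fderiv
    rw [show (fun y => molKernel k (x - y)) = molKernel k ∘ HSub.hSub x from rfl, this]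
    simp
  have h2 := hw _ htest v
  simp only [hfd] at h2
  have h3 : inner ℝ (mollify k D x) v = ∫ y, molKernel k (x - y) * inner ℝ (D y) v := by
    rw [mollify, convolution_eq_swap, real_inner_comm, ← integral_inner]
    · simp only [ContinuousLinearMap.lsmul_apply, real_inner_smul_right, real_inner_comm v]
    · have := (integrable_molKernel_smul k hD hDK x).comp_sub_left x
      simpa using this
  rw [h3, ← neg_eq_iff_eq_neg.2 h2.symm.symm, ← integral_neg]
  congr 1
  ext y
  simp only [ContinuousLinearMap.precompL_apply, ContinuousLinearMap.lsmul_apply, smul_eq_mul,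
    sub_sub_cancel]
  ring

end Mollifier

/-! ### Weights, bounded solutions and the differenced equation -/

section Caccioppoli

variable {n : ℕ}

/-- A smooth compactly supported weight `ζ ≥ 0` with `|Dζ|² ≤ ζ Θ`, where `ζ` and `Θ` have
integral at most `B`. -/
structure AdmissibleWeight (ζ Θ : Sp n → ℝ) (B : ℝ) : Prop where
  contDiff : ContDiff ℝ ∞ ζ
  compact : HasCompactSupport ζ
  nonneg : ∀ x, 0 ≤ ζ x
  nonneg_dom : ∀ x, 0 ≤ Θ x
  sq_le : ∀ x, ‖fderiv ℝ ζ x‖ ^ 2 ≤ ζ x * Θ x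
  integrable_dom : Integrable Θ
  integral_le : ∫ x, ζ x ≤ B
  integral_dom_le : ∫ x, Θ x ≤ B

/-- A pair `(u, D)` that is bounded by `K`, with `D` the weak gradient of `u` in `W`, and solves
`-div (H_{p-1}(D)) = F` in `W` for a right-hand side with controlled increments. -/
structure BoundedSolution (W : Set (Sp n)) (p K L M : ℝ) (u : Sp n → ℝ) (D : Sp n → Sp n)
    (F : Sp n → ℝ) : Prop where
  meas_u : Measurable u
  meas_D : Measurable D
  bound_u : ∀ x, ‖u x‖ ≤ K
  bound_D : ∀ x, ‖D x‖ ≤ K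
  weak : ∀ φ : Sp n → ℝ, IsTestFun W φ → ∀ v, ∫ x, u x * fderiv ℝ φ x v =
      -∫ x, φ x * inner ℝ (D x) v
  integrable_rhs : ∀ φ : Sp n → ℝ, IsTestFun W φ → Integrable (fun x => F x * φ x)
  eq : ∀ φ : Sp n → ℝ, IsTestFun W φ → ∫ x, fderiv ℝ φ x (H (p - 1) (D x)) = ∫ x, F x * φ x
  lip : ∀ h, ∀ᵐ x, x ∈ W → x + h ∈ W → |F (x + h) - F x| ≤ M * ‖h‖ + L * |u (x + h) - u x|

lemma AdmissibleWeight.integrable {ζ Θ : Sp n → ℝ} {B : ℝ} (hζ : AdmissibleWeight ζ Θ B) :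
    Integrable ζ :=
  hζ.contDiff.continuous.integrable_of_hasCompactSupport hζ.compact

lemma AdmissibleWeight.nonneg_bound {ζ Θ : Sp n → ℝ} {B : ℝ} (hζ : AdmissibleWeight ζ Θ B) :
    0 ≤ B := (integral_nonneg hζ.nonneg).trans hζ.integral_le

/-- Translation invariance with the same B is what makes the Caccioppoli estimate survive
mollification of G. -/
lemma AdmissibleWeight.translate {ζ Θ : Sp n → ℝ} {B : ℝ} (hζ : AdmissibleWeight ζ Θ B)
    (z : Sp n) : AdmissibleWeight (fun x => ζ (x + z)) (fun x => Θ (x + z)) B where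
  contDiff := hζ.contDiff.comp (contDiff_id.add contDiff_const)
  compact := hζ.compact.comp_homeomorph (Homeomorph.addRight z)
  nonneg x := hζ.nonneg _
  nonneg_dom x := hζ.nonneg_dom _
  sq_le x := by rw [fderiv_comp_add_right]; exact hζ.sq_le _
  integrable_dom := hζ.integrable_dom.comp_add_right z
  integral_le := by rw [integral_add_right_eq_self ζ z]; exact hζ.integral_le
  integral_dom_le := by rw [integral_add_right_eq_self Θ z]; exact hζ.integral_dom_le

lemma tsupport_comp_add_subset (ζ : Sp n → ℝ) (z : Sp n) :
    tsupport (fun x => ζ (x + z)) ⊆ (fun x => x + z) ⁻¹' tsupport ζ :=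
  tsupport_comp_subset_preimage ζ (f := fun x => x + z) (by fun_prop)

lemma IsTestFun.integrable_fderiv_apply {W : Set (Sp n)} {φ : Sp n → ℝ} (hφ : IsTestFun W φ)
    {V : Sp n → Sp n} {c : ℝ} (hV : Measurable V) (hc : ∀ x, ‖V x‖ ≤ c) :
    Integrable (fun x => fderiv ℝ φ x (V x)) := by
  have hcont : Continuous (fderiv ℝ φ) := hφ.1.continuous_fderiv (by simp)
  have hint : Integrable (fun x => ‖fderiv ℝ φ x‖) :=
    (hcont.integrable_of_hasCompactSupport (hφ.2.1.fderiv ℝ)).norm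
  refine (hint.mul_const c).mono' ?_ (Eventually.of_forall fun x => ?_)
  · exact (ContinuousLinearMap.id ℝ (Sp n →L[ℝ] ℝ)).aestronglyMeasurable_comp₂
      hcont.aestronglyMeasurable hV.aestronglyMeasurable
  · exact ((fderiv ℝ φ x).le_opNorm _).trans (by gcongr; exact hc x)

namespace BoundedSolution

variable {W : Set (Sp n)} {p K L M : ℝ} {u : Sp n → ℝ} {D : Sp n → Sp n} {F : Sp n → ℝ}

lemma nonneg_K (hs : BoundedSolution W p K L M u D F) : 0 ≤ K :=
  (norm_nonneg _).trans (hs.bound_u 0)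

lemma measurable_H_comp (hs : BoundedSolution W p K L M u D F) (q : ℝ) :
    Measurable fun x => H q (D x) := (measurable_H q).comp hs.meas_D

lemma norm_H_comp_le (hs : BoundedSolution W p K L M u D F) {q : ℝ} (hq : 0 < q) (x : Sp n) :
    ‖H q (D x)‖ ≤ K ^ q := norm_H_le_rpow hq (hs.bound_D x)

/-- Testing with φ(· - h) and with φ, then translating and subtracting, moves the difference onto
the field and onto F. -/
lemma integral_increment (hs : BoundedSolution W p K L M u D F) (hp : 2 ≤ p) {φ : Sp n → ℝ}
    {h : Sp n} (hφ : IsTestFun W φ) (hφh : IsTestFun W fun x => φ (x - h)) :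
    Integrable (fun x => (F (x + h) - F x) * φ x) ∧
    ∫ x, fderiv ℝ φ x (H (p - 1) (D (x + h)) - H (p - 1) (D x)) =
      ∫ x, (F (x + h) - F x) * φ x := by
  have hp1 : 0 < p - 1 := by linarith
  have i1 := hs.integrable_rhs φ hφ
  have i2 := (hs.integrable_rhs _ hφh).comp_add_right h
  simp only [add_sub_cancel_right] at i2
  have j1 := hφ.integrable_fderiv_apply (hs.measurable_H_comp (p - 1)) (hs.norm_H_comp_le hp1)
  have j2 := hφ.integrable_fderiv_apply
    ((hs.measurable_H_comp (p - 1)).comp (measurable_add_const h))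
    (fun x => hs.norm_H_comp_le hp1 (x + h))
  simp only [Function.comp_def] at j2
  have e1 := hs.eq φ hφ
  have e2 := hs.eq _ hφh
  rw [← integral_add_right_eq_self _ h, ← integral_add_right_eq_self (fun x => F x * φ (x - h)) h]
    at e2
  simp only [fderiv_comp_sub, add_sub_cancel_right] at e2
  simp only [sub_mul, map_sub]
  exact ⟨i2.sub i1, by rw [integral_sub j2 j1, integral_sub i2 i1, e1, e2]⟩

variable {S : Set (Sp n)} {r : ℝ} {h x : Sp n} {k : ℕ}

lemma norm_fderiv_mollify_le (hs : BoundedSolution W p K L M u D F)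
    (hx : Metric.closedBall x (molRadius k) ⊆ W) : ‖fderiv ℝ (mollify k u) x‖ ≤ K := by
  refine ContinuousLinearMap.opNorm_le_bound _ hs.nonneg_K fun v => ?_
  rw [fderiv_mollify_apply hs.meas_u hs.bound_u hs.meas_D hs.bound_D hs.weak k hx v]
  refine (norm_inner_le_norm _ _).trans ?_
  gcongr
  exact norm_mollify_le k hs.bound_D x

lemma differentiable_mollify (hs : BoundedSolution W p K L M u D F) :
    Differentiable ℝ (mollify k u) :=
  (contDiff_mollify k hs.meas_u hs.bound_u).differentiable (by simp)

lemma abs_mollify_increment_le (hs : BoundedSolution W p K L M u D F)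
    (hx : Metric.closedBall x (2 * r) ⊆ W) (hh : ‖h‖ ≤ r) (hk : molRadius k ≤ r) :
    |mollify k u (x + h) - mollify k u x| ≤ K * ‖h‖ := by
  have key := Convex.norm_image_sub_le_of_norm_fderiv_le (𝕜 := ℝ) (f := mollify k u)
    (s := Metric.closedBall x r) (C := K) (x := x) (y := x + h)
    (fun y _ => hs.differentiable_mollify y) (fun y hy => hs.norm_fderiv_mollify_le
      ((Metric.closedBall_subset_closedBall' (by rw [Metric.mem_closedBall] at hy; linarith)).trans
        hx)) (convex_closedBall x r)
    (Metric.mem_closedBall_self ((norm_nonneg h).trans hh)) (by simpa using hh)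
  simpa using key

/-- The representative u is merely bounded and measurable, so its Lipschitz bound is read off from
its mollifications, whose gradients are bounded by K, at almost every point. -/
lemma ae_abs_increment_le (hs : BoundedSolution W p K L M u D F)
    (hS : ∀ x ∈ S, Metric.closedBall x (2 * r) ⊆ W) (hr : 0 < r) (hh : ‖h‖ ≤ r) :
    ∀ᵐ x, x ∈ S → |u (x + h) - u x| ≤ K * ‖h‖ := by
  have h1 := ae_tendsto_mollify hs.meas_u hs.bound_u
  have h2 := (measurePreserving_add_right (volume : Measure (Sp n)) h).quasiMeasurePreserving.ae h1
  filter_upwards [h1, h2] with x hx1 hx2 hxS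
  refine le_of_tendsto (hx2.sub hx1).abs ?_
  filter_upwards [tendsto_molRadius.eventually_le_const hr] with k hk
  exact hs.abs_mollify_increment_le (hS x hxS) hh hk

end BoundedSolution

end Caccioppoli

/-! ### The weighted Caccioppoli estimate for difference quotients -/

namespace BoundedSolution

variable {n : ℕ} {W : Set (Sp n)} {p K L M : ℝ} {u : Sp n → ℝ} {D : Sp n → Sp n} {F : Sp n → ℝ}

/-- The constant in the difference quotient estimate. -/
def caccioppoliConst (p K L M B : ℝ) : ℝ :=
  2 * (2 * (p / 2 + 1) ^ 2) * (((M + L * K) * K + (2 * (p / 2 + 1) ^ 2) / 2 *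
    (K ^ 2 * (3 * (K ^ (p / 2)) ^ ((p - 2) / p)) ^ 2)) * B)

variable {S : Set (Sp n)} {r B : ℝ} {h : Sp n} {ζ Θ : Sp n → ℝ} {k : ℕ}

/-- Mollifying u makes ζ times its increment a genuine C_c^∞ function. The margin 2r leaves one r
for the shift by h and one for the mollification radius. -/
lemma isTestFun_weight_mul_increment (hs : BoundedSolution W p K L M u D F)
    (hζ : AdmissibleWeight ζ Θ B) (hζS : tsupport ζ ⊆ S)
    (hS : ∀ x ∈ S, Metric.closedBall x (2 * r) ⊆ W) (hr : 0 < r) (hh : ‖h‖ ≤ r) (k : ℕ) :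
    IsTestFun W (fun x => ζ x * (mollify k u (x + h) - mollify k u x)) ∧
    IsTestFun W (fun x => ζ (x - h) * (mollify k u (x - h + h) - mollify k u (x - h))) := by
  have hc := contDiff_mollify k hs.meas_u hs.bound_u
  have hφ : ContDiff ℝ ∞ (fun x => ζ x * (mollify k u (x + h) - mollify k u x)) :=
    hζ.contDiff.mul ((hc.comp (contDiff_id.add contDiff_const)).sub hc)
  have hcs : HasCompactSupport (fun x => ζ x * (mollify k u (x + h) - mollify k u x)) :=
    hζ.compact.mul_right
  have hts : tsupport (fun x => ζ x * (mollify k u (x + h) - mollify k u x)) ⊆ S :=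
    (tsupport_mul_subset_left (f := ζ)
      (g := fun x => mollify k u (x + h) - mollify k u x)).trans hζS
  refine ⟨⟨hφ, hcs, fun x hx => hS x (hts hx) (Metric.mem_closedBall_self (by linarith))⟩,
    hφ.comp (contDiff_id.sub contDiff_const), hcs.comp_homeomorph (Homeomorph.subRight h), ?_⟩
  refine (tsupport_comp_subset_preimage
    (fun x => ζ x * (mollify k u (x + h) - mollify k u x)) (f := fun x => x - h) (by fun_prop)).trans ?_
  intro x hx
  refine hS (x - h) (hts hx) ?_
  rw [Metric.mem_closedBall, dist_eq_norm, sub_sub_cancel]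
  linarith

lemma fderiv_weight_mul_increment (hs : BoundedSolution W p K L M u D F)
    (hζ : AdmissibleWeight ζ Θ B) (hζS : tsupport ζ ⊆ S)
    (hS : ∀ x ∈ S, Metric.closedBall x (2 * r) ⊆ W) (hr : 0 < r) (hh : ‖h‖ ≤ r)
    (hk : molRadius k ≤ r) (x v : Sp n) :
    fderiv ℝ (fun x => ζ x * (mollify k u (x + h) - mollify k u x)) x v =
      ζ x * inner ℝ (mollify k D (x + h) - mollify k D x) v +
        (mollify k u (x + h) - mollify k u x) * fderiv ℝ ζ x v := by
  have hd := hs.differentiable_mollify (k := k)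
  have hdh : DifferentiableAt ℝ (fun x => mollify k u (x + h)) x :=
    (hd (x + h)).comp x (differentiableAt_id.add_const h)
  have e1 : fderiv ℝ (fun x => mollify k u (x + h) - mollify k u x) x v =
      fderiv ℝ (mollify k u) (x + h) v - fderiv ℝ (mollify k u) x v := by
    rw [fderiv_fun_sub hdh (hd x), fderiv_comp_add_right]
    rfl
  rw [fderiv_fun_mul (hζ.contDiff.differentiable (by simp) x)
    (hdh.fun_sub (hd x))]
  simp only [add_apply, smul_apply, smul_eq_mul, e1]
  congr 1
  by_cases hx : x ∈ tsupport ζ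
  · have hx' := hS x (hζS hx)
    rw [fderiv_mollify_apply hs.meas_u hs.bound_u hs.meas_D hs.bound_D hs.weak k
        ((Metric.closedBall_subset_closedBall' (by simp; linarith)).trans hx') v,
      fderiv_mollify_apply hs.meas_u hs.bound_u hs.meas_D hs.bound_D hs.weak k
        ((Metric.closedBall_subset_closedBall (by linarith)).trans hx') v, inner_sub_left]
  · rw [image_eq_zero_of_notMem_tsupport hx, zero_mul, zero_mul]

/-- The increments of F and of the mollified u are at most (M + LK)|h| and K|h|, which produces the
factor |h|². -/
lemma integral_weight_increment_le (hs : BoundedSolution W p K L M u D F) (hp : 2 ≤ p)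
    (hL : 0 ≤ L) (hM : 0 ≤ M) (hζ : AdmissibleWeight ζ Θ B) (hζS : tsupport ζ ⊆ S)
    (hS : ∀ x ∈ S, Metric.closedBall x (2 * r) ⊆ W) (hr : 0 < r) (hh : ‖h‖ ≤ r)
    (hk : molRadius k ≤ r) :
    ∫ x, (ζ x * inner ℝ (mollify k D (x + h) - mollify k D x)
        (H (p - 1) (D (x + h)) - H (p - 1) (D x)) +
      (mollify k u (x + h) - mollify k u x) *
        fderiv ℝ ζ x (H (p - 1) (D (x + h)) - H (p - 1) (D x))) ≤
      (M + L * K) * K * B * ‖h‖ ^ 2 := by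
  obtain ⟨hφ, hφh⟩ := hs.isTestFun_weight_mul_increment hζ hζS hS hr hh k
  obtain ⟨hint, heq⟩ := hs.integral_increment hp hφ hφh
  have hK := hs.nonneg_K
  simp only [hs.fderiv_weight_mul_increment hζ hζS hS hr hh hk] at heq
  rw [heq]
  have hle : ∀ᵐ x, (F (x + h) - F x) * (ζ x * (mollify k u (x + h) - mollify k u x)) ≤
      (M + L * K) * K * ‖h‖ ^ 2 * ζ x := by
    filter_upwards [hs.lip h, hs.ae_abs_increment_le hS hr hh] with x hx1 hx2
    by_cases hx : x ∈ tsupport ζ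
    · have hxS := hζS hx
      have a1 := hx2 hxS
      have a2 := hx1 (hS x hxS (Metric.mem_closedBall_self (by linarith)))
        (hS x hxS (by simp; linarith))
      have a3 := hs.abs_mollify_increment_le (hS x hxS) hh hk
      have a4 : |F (x + h) - F x| ≤ (M + L * K) * ‖h‖ := by
        have := mul_le_mul_of_nonneg_left a1 hL
        linarith
      have hz := hζ.nonneg x
      calc _ ≤ |F (x + h) - F x| * |mollify k u (x + h) - mollify k u x| * ζ x := by
            rw [mul_left_comm, mul_comm, ← abs_mul]
            gcongr
            exact le_abs_self _
        _ ≤ ((M + L * K) * ‖h‖) * (K * ‖h‖) * ζ x := by gcongr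
        _ = _ := by ring
    · rw [image_eq_zero_of_notMem_tsupport hx]; simp
  refine (integral_mono_ae hint (hζ.integrable.const_mul _) hle).trans ?_
  rw [integral_const_mul]
  have := mul_le_mul_of_nonneg_left hζ.integral_le
    (by positivity : 0 ≤ (M + L * K) * K * ‖h‖ ^ 2)
  linarith

lemma norm_H_increment_le (hs : BoundedSolution W p K L M u D F) (hp : 2 ≤ p) (x y : Sp n) :
    ‖H (p - 1) (D x) - H (p - 1) (D y)‖ ≤ 2 * K ^ (p - 1) := by
  refine (norm_sub_le _ _).trans ?_
  have h1 := hs.norm_H_comp_le (q := p - 1) (by linarith) x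
  have h2 := hs.norm_H_comp_le (q := p - 1) (by linarith) y
  linarith

lemma norm_increment_le {E' : Type*} [NormedAddCommGroup E'] {g : Sp n → E'}
    (hg : ∀ x, ‖g x‖ ≤ K) (x y : Sp n) : ‖g x - g y‖ ≤ 2 * K := by
  refine (norm_sub_le _ _).trans ?_
  linarith [hg x, hg y]

lemma norm_weight_integrand_le (hs : BoundedSolution W p K L M u D F)
    (hζ : AdmissibleWeight ζ Θ B) {a : ℝ} {d v x : Sp n} (hd : ‖d‖ ≤ 2 * K)
    (ha : ‖a‖ ≤ 2 * K) (hv : ‖v‖ ≤ 2 * K ^ (p - 1)) :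
    ‖ζ x * inner ℝ d v + a * fderiv ℝ ζ x v‖ ≤
      2 * K * (2 * K ^ (p - 1)) * (ζ x + ‖fderiv ℝ ζ x‖) := by
  have hK := hs.nonneg_K
  have hz := hζ.nonneg x
  have h1 : ‖inner ℝ d v‖ ≤ 2 * K * (2 * K ^ (p - 1)) :=
    (norm_inner_le_norm _ _).trans (by gcongr)
  have h2 : ‖fderiv ℝ ζ x v‖ ≤ ‖fderiv ℝ ζ x‖ * (2 * K ^ (p - 1)) :=
    ((fderiv ℝ ζ x).le_opNorm v).trans (by gcongr)
  calc _ ≤ ζ x * (2 * K * (2 * K ^ (p - 1))) +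
        2 * K * (‖fderiv ℝ ζ x‖ * (2 * K ^ (p - 1))) := by
        refine (norm_add_le _ _).trans ?_
        rw [norm_mul, norm_mul, Real.norm_of_nonneg hz]
        gcongr
    _ = _ := by ring

/-- Only the test function was mollified, not the field; the mollified factors are bounded by K and
converge almost everywhere, so dominated convergence removes them. -/
lemma integral_weight_limit_le (hs : BoundedSolution W p K L M u D F) (hp : 2 ≤ p)
    (hL : 0 ≤ L) (hM : 0 ≤ M) (hζ : AdmissibleWeight ζ Θ B) (hζS : tsupport ζ ⊆ S)
    (hS : ∀ x ∈ S, Metric.closedBall x (2 * r) ⊆ W) (hr : 0 < r) (hh : ‖h‖ ≤ r) :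
    Integrable (fun x => ζ x * inner ℝ (D (x + h) - D x)
        (H (p - 1) (D (x + h)) - H (p - 1) (D x)) +
      (u (x + h) - u x) * fderiv ℝ ζ x (H (p - 1) (D (x + h)) - H (p - 1) (D x))) ∧
    ∫ x, (ζ x * inner ℝ (D (x + h) - D x) (H (p - 1) (D (x + h)) - H (p - 1) (D x)) +
      (u (x + h) - u x) * fderiv ℝ ζ x (H (p - 1) (D (x + h)) - H (p - 1) (D x))) ≤
      (M + L * K) * K * B * ‖h‖ ^ 2 := by
  have hqmp := (measurePreserving_add_right (volume : Measure (Sp n)) h).quasiMeasurePreserving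
  have hcont : Continuous (fderiv ℝ ζ) := hζ.contDiff.continuous_fderiv (by simp)
  have hV : Measurable fun x => H (p - 1) (D (x + h)) - H (p - 1) (D x) :=
    ((hs.measurable_H_comp (p - 1)).comp (measurable_add_const h)).sub (hs.measurable_H_comp (p - 1))
  have hmeas : ∀ {v : Sp n → ℝ} {E : Sp n → Sp n}, Measurable v → Measurable E →
      AEStronglyMeasurable (fun x => ζ x * inner ℝ (E (x + h) - E x)
        (H (p - 1) (D (x + h)) - H (p - 1) (D x)) +
      (v (x + h) - v x) * fderiv ℝ ζ x (H (p - 1) (D (x + h)) - H (p - 1) (D x))) volume := by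
    intro v E hv hE
    have hE' : Measurable fun x => E (x + h) - E x := (hE.comp (measurable_add_const h)).sub hE
    have hv' : Measurable fun x => v (x + h) - v x := (hv.comp (measurable_add_const h)).sub hv
    refine ((hζ.contDiff.continuous.measurable.mul (hE'.inner hV)).aestronglyMeasurable).add
      (hv'.aestronglyMeasurable.mul ?_)
    exact (ContinuousLinearMap.id ℝ (Sp n →L[ℝ] ℝ)).aestronglyMeasurable_comp₂
      hcont.aestronglyMeasurable hV.aestronglyMeasurable
  have hbound : Integrable (fun x => 2 * K * (2 * K ^ (p - 1)) * (ζ x + ‖fderiv ℝ ζ x‖)) :=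
    (hζ.integrable.add (hcont.integrable_of_hasCompactSupport (hζ.compact.fderiv ℝ)).norm).const_mul _
  have hVb := fun x => hs.norm_H_increment_le hp (x + h) x
  refine ⟨hbound.mono' (hmeas hs.meas_u hs.meas_D) (Eventually.of_forall fun x =>
    hs.norm_weight_integrand_le hζ (norm_increment_le hs.bound_D _ _)
      (norm_increment_le hs.bound_u _ _) (hVb x)), ?_⟩
  have hlim := tendsto_integral_of_dominated_convergence (μ := (volume : Measure (Sp n)))
    (F := fun k x => ζ x * inner ℝ (mollify k D (x + h) - mollify k D x)
        (H (p - 1) (D (x + h)) - H (p - 1) (D x)) +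
      (mollify k u (x + h) - mollify k u x) *
        fderiv ℝ ζ x (H (p - 1) (D (x + h)) - H (p - 1) (D x)))
    (f := fun x => ζ x * inner ℝ (D (x + h) - D x) (H (p - 1) (D (x + h)) - H (p - 1) (D x)) +
      (u (x + h) - u x) * fderiv ℝ ζ x (H (p - 1) (D (x + h)) - H (p - 1) (D x)))
    _ (fun k => hmeas (contDiff_mollify k hs.meas_u hs.bound_u).continuous.measurable
      (contDiff_mollify k hs.meas_D hs.bound_D).continuous.measurable) hbound
    (fun k => Eventually.of_forall fun x => hs.norm_weight_integrand_le hζ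
      (norm_increment_le (norm_mollify_le k hs.bound_D) _ _)
      (norm_increment_le (norm_mollify_le k hs.bound_u) _ _) (hVb x)) ?_
  · refine le_of_tendsto hlim ?_
    filter_upwards [tendsto_molRadius.eventually_le_const hr] with k hk
    exact hs.integral_weight_increment_le hp hL hM hζ hζS hS hr hh hk
  · have hD1 := ae_tendsto_mollify hs.meas_D hs.bound_D
    have hu1 := ae_tendsto_mollify hs.meas_u hs.bound_u
    filter_upwards [hD1, hu1, hqmp.ae hD1, hqmp.ae hu1] with x a b c d
    exact (((c.sub a).inner tendsto_const_nhds).const_mul _).add ((d.sub b).mul_const _)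

/-- Monotonicity bounds ζ |G(x+h) - G(x)|² by the first part of the integrand; the part with Dζ is
linear in the increment of G and is absorbed by Young's inequality through |Dζ|² ≤ ζ Θ. -/
theorem integral_increment_sq_le (hs : BoundedSolution W p K L M u D F) (hp : 2 ≤ p)
    (hL : 0 ≤ L) (hM : 0 ≤ M) (hζ : AdmissibleWeight ζ Θ B) (hζS : tsupport ζ ⊆ S)
    (hS : ∀ x ∈ S, Metric.closedBall x (2 * r) ⊆ W) (hr : 0 < r) (hh : ‖h‖ ≤ r) :
    ∫ x, ζ x * ‖H (p / 2) (D (x + h)) - H (p / 2) (D x)‖ ^ 2 ≤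
      caccioppoliConst p K L M B * ‖h‖ ^ 2 := by
  obtain ⟨hint, hle⟩ := hs.integral_weight_limit_le hp hL hM hζ hζS hS hr hh
  set c : ℝ := 2 * (p / 2 + 1) ^ 2 with hc
  set c₃ : ℝ := 3 * (K ^ (p / 2)) ^ ((p - 2) / p) with hc₃
  have hc0 : 0 < c := by have : 0 < p / 2 + 1 := by linarith
                         positivity
  have hK := hs.nonneg_K
  have hc₃0 : 0 ≤ c₃ := by positivity
  set I : Sp n → ℝ := fun x => ζ x * inner ℝ (D (x + h) - D x)
    (H (p - 1) (D (x + h)) - H (p - 1) (D x)) +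
      (u (x + h) - u x) * fderiv ℝ ζ x (H (p - 1) (D (x + h)) - H (p - 1) (D x)) with hI
  -- The factor 2c yields two copies of the left side; one of them pays for the cross term.
  have hpt : ∀ᵐ x, ζ x * ‖H (p / 2) (D (x + h)) - H (p / 2) (D x)‖ ^ 2 ≤
      2 * c * (I x + c / 2 * (K ^ 2 * c₃ ^ 2 * ‖h‖ ^ 2) * Θ x) := by
    filter_upwards [hs.ae_abs_increment_le hS hr hh] with x hx
    have hz := hζ.nonneg x
    have hΘ := hζ.nonneg_dom x
    have b1 := norm_H_half_sub_sq_le hp (D (x + h)) (D x)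
    have b2 := norm_H_sub_le hp (hs.bound_D (x + h)) (hs.bound_D x)
    rw [← hc, real_inner_comm] at b1
    rw [← hc₃] at b2
    set V := H (p - 1) (D (x + h)) - H (p - 1) (D x)
    set g := ‖H (p / 2) (D (x + h)) - H (p / 2) (D x)‖
    have hg : 0 ≤ g := norm_nonneg _
    have b3 : |(u (x + h) - u x) * fderiv ℝ ζ x V| ≤
        (K * ‖h‖) * (‖fderiv ℝ ζ x‖ * (c₃ * g)) := by
      by_cases hxs : x ∈ tsupport ζ
      · rw [abs_mul]
        have := hx (hζS hxs)
        have h2 : |fderiv ℝ ζ x V| ≤ ‖fderiv ℝ ζ x‖ * (c₃ * g) :=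
          ((fderiv ℝ ζ x).le_opNorm V).trans (by gcongr)
        gcongr
      · have : fderiv ℝ ζ x = 0 :=
          image_eq_zero_of_notMem_tsupport (f := fderiv ℝ ζ)
            (fun hh' => hxs (tsupport_fderiv_subset ℝ hh'))
        simp [this]
    -- The inequality 2P ≤ X + Y with P² ≤ XY, the latter being |Dζ|² ≤ ζ Θ multiplied by a square.
    have b4 : 2 * c * ((K * ‖h‖) * (‖fderiv ℝ ζ x‖ * (c₃ * g))) ≤
        ζ x * g ^ 2 + c ^ 2 * (K ^ 2 * c₃ ^ 2 * ‖h‖ ^ 2) * Θ x := by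
      set X := ζ x * g ^ 2
      set Y := c ^ 2 * (K ^ 2 * c₃ ^ 2 * ‖h‖ ^ 2) * Θ x
      set P := c * ((K * ‖h‖) * (‖fderiv ℝ ζ x‖ * (c₃ * g)))
      have hX : 0 ≤ X := by positivity
      have hY : 0 ≤ Y := by positivity
      have hP : P ^ 2 ≤ X * Y := by
        have e1 : P ^ 2 = ‖fderiv ℝ ζ x‖ ^ 2 * (c ^ 2 * (K ^ 2 * ‖h‖ ^ 2 * (c₃ ^ 2 * g ^ 2))) := by
          simp only [P]; ring
        have e2 : X * Y = ζ x * Θ x * (c ^ 2 * (K ^ 2 * ‖h‖ ^ 2 * (c₃ ^ 2 * g ^ 2))) := by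
          simp only [X, Y]; ring
        rw [e1, e2]
        gcongr
        exact hζ.sq_le x
      have h4 : (2 * P) ^ 2 ≤ (X + Y) ^ 2 := by nlinarith [sq_nonneg (X - Y)]
      have h5 : 2 * P ≤ X + Y := (le_abs_self _).trans (abs_le_of_sq_le_sq h4 (by positivity))
      have h6 : 2 * c * ((K * ‖h‖) * (‖fderiv ℝ ζ x‖ * (c₃ * g))) = 2 * P := by
        simp only [P]; ring
      linarith
    have b5 := mul_le_mul_of_nonneg_left b1 hz
    have b6 := neg_le_of_abs_le b3
    simp only [hI]
    have b7 := mul_le_mul_of_nonneg_left b6 (by positivity : 0 ≤ 2 * c)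
    linarith
  have hint2 : Integrable (fun x => 2 * c * (I x + c / 2 * (K ^ 2 * c₃ ^ 2 * ‖h‖ ^ 2) * Θ x)) :=
    (hint.add (hζ.integrable_dom.const_mul _)).const_mul _
  refine (integral_mono_of_nonneg (Eventually.of_forall fun x => ?_) hint2 hpt).trans ?_
  · exact mul_nonneg (hζ.nonneg x) (sq_nonneg _)
  rw [integral_const_mul, integral_add hint (hζ.integrable_dom.const_mul _), integral_const_mul]
  have f1 := mul_le_mul_of_nonneg_left hζ.integral_dom_le
    (by positivity : 0 ≤ c / 2 * (K ^ 2 * c₃ ^ 2 * ‖h‖ ^ 2))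
  have f2 := mul_le_mul_of_nonneg_left (add_le_add hle f1) (by positivity : 0 ≤ 2 * c)
  refine f2.trans (le_of_eq ?_)
  simp only [caccioppoliConst, ← hc, ← hc₃]
  ring

end BoundedSolution

/-! ### Mollification under a weight -/

section WeightedMollification

variable {n : ℕ}

lemma integrable_molKernel_mul (k : ℕ) {q : Sp n → ℝ} {c : ℝ} (hq : Measurable q)
    (hc : ∀ x, ‖q x‖ ≤ c) (x : Sp n) : Integrable (fun z => molKernel k z * q (x - z)) :=
  integrable_molKernel_smul k hq hc x

lemma integrable_prod_weight_kernel (k : ℕ) {ζ q : Sp n → ℝ} {c : ℝ} (hζ : Integrable ζ)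
    (hq : Measurable q) (hc : ∀ x, ‖q x‖ ≤ c) :
    Integrable (fun w : Sp n × Sp n => molKernel k w.2 * (ζ w.1 * q (w.1 - w.2)))
      (volume.prod volume) := by
  have h1 : Integrable (fun w : Sp n × Sp n => ζ w.1 * molKernel k w.2) (volume.prod volume) :=
    hζ.mul_prod (integrable_molKernel k)
  have h2 := h1.mul_bdd (c := c) (g := fun w : Sp n × Sp n => q (w.1 - w.2))
    (hq.comp (measurable_fst.sub measurable_snd)).aestronglyMeasurable
    (Eventually.of_forall fun w => hc _)
  refine h2.congr (Eventually.of_forall fun w => ?_)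
  ring

/-- Fubini and a change of variables move the shift z from q to ζ, so a bound uniform over small
translates of the weight suffices. -/
lemma integral_weight_kernel_le (k : ℕ) {ζ q : Sp n → ℝ} {c C : ℝ} (hζ : Integrable ζ)
    (hq : Measurable q) (hc : ∀ x, ‖q x‖ ≤ c)
    (hC : ∀ z, ‖z‖ ≤ molRadius k → ∫ x, ζ (x + z) * q x ≤ C) :
    ∫ x, ∫ z, molKernel k z * (ζ x * q (x - z)) ≤ C := by
  have hint := integrable_prod_weight_kernel k hζ hq hc
  have e := integral_integral_swap (f := fun x z => molKernel k z * (ζ x * q (x - z))) hint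
  rw [e]
  have hi : Integrable fun z : Sp n => ∫ x, molKernel k z * (ζ x * q (x - z)) :=
    hint.integral_prod_right
  have : ∀ z : Sp n, ∫ x, molKernel k z * (ζ x * q (x - z)) ≤ molKernel k z * C := by
    intro z
    rw [integral_const_mul]
    by_cases hz : z ∈ tsupport (molKernel k)
    · rw [tsupport_molKernel, mem_closedBall_zero_iff] at hz
      refine mul_le_mul_of_nonneg_left ?_ (molKernel_nonneg k z)
      rw [← integral_add_right_eq_self _ z]
      simpa using hC z hz
    · simp [image_eq_zero_of_notMem_tsupport hz]
  refine (integral_mono hi ((integrable_molKernel k).mul_const C) this).trans_eq ?_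
  rw [integral_mul_const, integral_molKernel, one_mul]

lemma norm_mollify_add_sub_le {E' : Type*} [NormedAddCommGroup E'] [NormedSpace ℝ E']
    [MeasurableSpace E'] [BorelSpace E'] [SecondCountableTopology E'] (k : ℕ) {g : Sp n → E'}
    {c : ℝ} (hg : Measurable g) (hc : ∀ x, ‖g x‖ ≤ c) (x h : Sp n) :
    ‖mollify k g (x + h) - mollify k g x‖ ≤
      ∫ z, molKernel k z * ‖g (x - z + h) - g (x - z)‖ := by
  rw [mollify_add_sub k hg hc]
  refine (norm_integral_le_integral_norm _).trans_eq ?_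
  simp only [norm_smul, Real.norm_of_nonneg (molKernel_nonneg k _)]

end WeightedMollification

/-! ### From difference quotients to derivatives of the mollified G -/

namespace BoundedSolution

variable {n : ℕ} {W : Set (Sp n)} {p K L M : ℝ} {u : Sp n → ℝ} {D : Sp n → Sp n} {F : Sp n → ℝ}
  {S : Set (Sp n)} {r B : ℝ} {h : Sp n} {ζ Θ : Sp n → ℝ} {k : ℕ}

lemma integral_translated_weight_le (hs : BoundedSolution W p K L M u D F) (hp : 2 ≤ p)
    (hL : 0 ≤ L) (hM : 0 ≤ M) (hζ : AdmissibleWeight ζ Θ B) (hζS : tsupport ζ ⊆ S)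
    (hS : ∀ x ∈ S, Metric.closedBall x (3 * r) ⊆ W) (hr : 0 < r) (hh : ‖h‖ ≤ r) {z : Sp n}
    (hz : ‖z‖ ≤ r) :
    ∫ x, ζ (x + z) * ‖H (p / 2) (D (x + h)) - H (p / 2) (D x)‖ ^ 2 ≤
      caccioppoliConst p K L M B * ‖h‖ ^ 2 := by
  refine hs.integral_increment_sq_le hp hL hM (hζ.translate z) (S := (fun x => x + z) ⁻¹' S)
    ((tsupport_comp_add_subset ζ z).trans (preimage_mono hζS)) (fun x hx => ?_) hr hh
  refine (Metric.closedBall_subset_closedBall' ?_).trans (hS _ hx)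
  rw [dist_self_add_right]
  linarith

/-- A is a bounded factor, later |H_{p-1}(Du)| |DΨ(G_k)| with G_k the mollified G. Its sup bound a
only ensures integrability and does not enter the estimate. -/
lemma integral_weight_mul_mollify_increment_le (hs : BoundedSolution W p K L M u D F)
    (hp : 2 ≤ p) (hL : 0 ≤ L) (hM : 0 ≤ M) (hζ : AdmissibleWeight ζ Θ B) (hζS : tsupport ζ ⊆ S)
    (hS : ∀ x ∈ S, Metric.closedBall x (3 * r) ⊆ W) (hr : 0 < r) (hh : ‖h‖ ≤ r) (hh0 : h ≠ 0)
    (hk : molRadius k ≤ r) {A : Sp n → ℝ} {a τ : ℝ} (hA : Measurable A) (hA0 : ∀ x, 0 ≤ A x)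
    (hAa : ∀ x, A x ≤ a) (hτ : 0 < τ) :
    ∫ x, ζ x * (A x * ‖mollify k (fun y => H (p / 2) (D y)) (x + h) -
        mollify k (fun y => H (p / 2) (D y)) x‖) ≤
      ‖h‖ * (τ * (∫ x, ζ x * A x ^ 2) + caccioppoliConst p K L M B / (4 * τ)) := by
  set G : Sp n → Sp n := fun y => H (p / 2) (D y) with hG
  have hGm : Measurable G := hs.measurable_H_comp _
  have hGb : ∀ x, ‖G x‖ ≤ K ^ (p / 2) := hs.norm_H_comp_le (by linarith)
  set q : Sp n → ℝ := fun y => ‖G (y + h) - G y‖ with hq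
  have hqm : Measurable q := ((hGm.comp (measurable_add_const h)).sub hGm).norm
  have hq0 : ∀ x, 0 ≤ q x := fun x => norm_nonneg _
  have hqb : ∀ x, ‖q x‖ ≤ 2 * K ^ (p / 2) := fun x => by
    rw [hq, norm_norm]; exact norm_increment_le hGb _ _
  have hq2b : ∀ x, ‖q x ^ 2‖ ≤ (2 * K ^ (p / 2)) ^ 2 := fun x => by
    rw [norm_pow]; gcongr; exact hqb x
  have hs0 : 0 < ‖h‖ := norm_pos_iff.2 hh0
  have hprod := integrable_prod_weight_kernel k hζ.integrable (hqm.pow_const 2) hq2b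
  have hint1 : Integrable fun x => ∫ z, molKernel k z * (ζ x * q (x - z) ^ 2) :=
    hprod.integral_prod_left
  have hint2 : Integrable fun x => ζ x * A x ^ 2 := by
    refine hζ.integrable.mul_bdd (c := a ^ 2) (hA.pow_const 2).aestronglyMeasurable
      (Eventually.of_forall fun x => ?_)
    rw [norm_pow, Real.norm_of_nonneg (hA0 x)]
    exact pow_le_pow_left₀ (hA0 x) (hAa x) 2
  have hpt : ∀ x, ζ x * (A x * ‖mollify k G (x + h) - mollify k G x‖) ≤
      ‖h‖ * τ * (ζ x * A x ^ 2) +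
        1 / (4 * τ * ‖h‖) * ∫ z, molKernel k z * (ζ x * q (x - z) ^ 2) := by
    intro x
    have hz := hζ.nonneg x
    have e1 : ∫ z, molKernel k z * (ζ x * q (x - z) ^ 2) =
        ζ x * ∫ z, molKernel k z * q (x - z) ^ 2 := by
      rw [← integral_const_mul]; congr 1; ext z; ring
    have i1 := integrable_molKernel_mul k hqm hqb x
    have i2 := integrable_molKernel_mul k (hqm.pow_const 2) hq2b x
    have e2 : A x * ‖mollify k G (x + h) - mollify k G x‖ ≤
        ‖h‖ * τ * A x ^ 2 + 1 / (4 * τ * ‖h‖) * ∫ z, molKernel k z * q (x - z) ^ 2 := by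
      calc _ ≤ A x * ∫ z, molKernel k z * q (x - z) := by
            gcongr
            · exact hA0 x
            · exact norm_mollify_add_sub_le k hGm hGb x h
        _ = ∫ z, A x * (molKernel k z * q (x - z)) := (integral_const_mul _ _).symm
        _ ≤ ∫ z, (‖h‖ * τ * A x ^ 2 * molKernel k z +
              1 / (4 * τ * ‖h‖) * (molKernel k z * q (x - z) ^ 2)) := by
            refine integral_mono (i1.const_mul _)
              (((integrable_molKernel k).const_mul _).add (i2.const_mul _)) fun z => ?_
            have hχ := molKernel_nonneg k z
            -- Young's inequality scaled by |h|: as ∫ ζ q² is of order |h|², both resulting terms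
            -- are of order |h|, ready for division by |h|.
            have hy : A x * q (x - z) ≤
                ‖h‖ * τ * A x ^ 2 + 1 / (4 * τ * ‖h‖) * q (x - z) ^ 2 := by
              have : ‖h‖ * τ * A x ^ 2 + 1 / (4 * τ * ‖h‖) * q (x - z) ^ 2 - A x * q (x - z) =
                  1 / (4 * τ * ‖h‖) * (2 * τ * ‖h‖ * A x - q (x - z)) ^ 2 := by
                field_simp; ring
              have h2 : 0 ≤ 1 / (4 * τ * ‖h‖) * (2 * τ * ‖h‖ * A x - q (x - z)) ^ 2 := by
                positivity
              linarith
            have := mul_le_mul_of_nonneg_left hy hχ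
            calc _ = molKernel k z * (A x * q (x - z)) := by ring
              _ ≤ _ := this
              _ = _ := by ring
        _ = _ := by
            rw [integral_add ((integrable_molKernel k).const_mul _) (i2.const_mul _),
              integral_const_mul, integral_const_mul, integral_molKernel, mul_one]
    rw [e1]
    have := mul_le_mul_of_nonneg_left e2 hz
    calc _ ≤ _ := this
      _ = _ := by ring
  refine (integral_mono_of_nonneg (Eventually.of_forall fun x => ?_)
    ((hint2.const_mul _).add (hint1.const_mul _)) (Eventually.of_forall hpt)).trans ?_
  · exact mul_nonneg (hζ.nonneg x) (mul_nonneg (hA0 x) (norm_nonneg _))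
  rw [Pi.add_def, integral_add (hint2.const_mul _) (hint1.const_mul _), integral_const_mul,
    integral_const_mul]
  have h3 := integral_weight_kernel_le k hζ.integrable (hqm.pow_const 2) hq2b
    (C := caccioppoliConst p K L M B * ‖h‖ ^ 2) (fun z hz =>
      hs.integral_translated_weight_le hp hL hM hζ hζS hS hr hh (hz.trans hk))
  have h4 := mul_le_mul_of_nonneg_left h3 (by positivity : 0 ≤ 1 / (4 * τ * ‖h‖))
  have h5 : 1 / (4 * τ * ‖h‖) * (caccioppoliConst p K L M B * ‖h‖ ^ 2) =
      ‖h‖ * (caccioppoliConst p K L M B / (4 * τ)) := by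
    field_simp
  linarith

/-- Divide the increment estimate by |h| along h = s_j e with s_j → 0 and apply Fatou's lemma. -/
lemma integral_weight_mul_fderiv_mollify_le (hs : BoundedSolution W p K L M u D F)
    (hp : 2 ≤ p) (hL : 0 ≤ L) (hM : 0 ≤ M) (hζ : AdmissibleWeight ζ Θ B) (hζS : tsupport ζ ⊆ S)
    (hS : ∀ x ∈ S, Metric.closedBall x (3 * r) ⊆ W) (hr : 0 < r)
    (hk : molRadius k ≤ r) {A : Sp n → ℝ} {a τ : ℝ} (hA : Measurable A) (hA0 : ∀ x, 0 ≤ A x)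
    (hAa : ∀ x, A x ≤ a) (hτ : 0 < τ) {e : Sp n} (he : ‖e‖ = 1) :
    Integrable (fun x => ζ x *
      (A x * ‖fderiv ℝ (mollify k (fun y => H (p / 2) (D y))) x e‖)) ∧
    ∫ x, ζ x * (A x * ‖fderiv ℝ (mollify k (fun y => H (p / 2) (D y))) x e‖) ≤
      τ * (∫ x, ζ x * A x ^ 2) + caccioppoliConst p K L M B / (4 * τ) := by
  set G : Sp n → Sp n := fun y => H (p / 2) (D y) with hG
  have hGm : Measurable G := hs.measurable_H_comp _
  have hGb : ∀ x, ‖G x‖ ≤ K ^ (p / 2) := hs.norm_H_comp_le (by linarith)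
  have hsm := contDiff_mollify k hGm hGb
  have hcont : Continuous fun x => ‖fderiv ℝ (mollify k G) x e‖ :=
    ((hsm.continuous_fderiv (by simp)).clm_apply continuous_const).norm
  have hint : Integrable (fun x => ζ x * (A x * ‖fderiv ℝ (mollify k G) x e‖)) := by
    have h1 : Integrable fun x => ζ x * ‖fderiv ℝ (mollify k G) x e‖ :=
      (hζ.contDiff.continuous.mul hcont).integrable_of_hasCompactSupport hζ.compact.mul_right
    refine (h1.mul_bdd (c := a) hA.aestronglyMeasurable (Eventually.of_forall fun x => ?_)).congr
      (Eventually.of_forall fun x => by ring)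
    rw [Real.norm_of_nonneg (hA0 x)]; exact hAa x
  refine ⟨hint, ?_⟩
  -- Any positive null sequence would do as step size; the mollification index k stays fixed.
  set s : ℕ → ℝ := fun j => molRadius j with hsdef
  have hs0 : ∀ j, 0 < s j := molRadius_pos
  set q : ℕ → Sp n → ℝ := fun j x => ζ x * (A x * ‖(s j)⁻¹ • (mollify k G (x + s j • e) -
    mollify k G x)‖) with hqdef
  have hq0 : ∀ j x, 0 ≤ q j x := fun j x =>
    mul_nonneg (hζ.nonneg x) (mul_nonneg (hA0 x) (norm_nonneg _))
  have hcs : ∀ j, Continuous fun x => ‖(s j)⁻¹ • (mollify k G (x + s j • e) - mollify k G x)‖ := by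
    intro j
    have hc := hsm.continuous
    fun_prop
  have hqm : ∀ j, Measurable (q j) := fun j =>
    hζ.contDiff.continuous.measurable.mul (hA.mul (hcs j).measurable)
  have hlim : ∀ x, Tendsto (fun j => q j x) atTop
      (𝓝 (ζ x * (A x * ‖fderiv ℝ (mollify k G) x e‖))) := by
    intro x
    have h1 : HasLineDerivAt ℝ (mollify k G) (fderiv ℝ (mollify k G) x e) x e :=
      ((hsm.differentiable (by simp)) x).hasFDerivAt.hasLineDerivAt e
    have h2 := h1.tendsto_slope_zero_right.comp (tendsto_nhdsWithin_iff.2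
      ⟨tendsto_molRadius, Eventually.of_forall fun j => molRadius_pos j⟩)
    exact (h2.norm.const_mul _).const_mul _
  set R := τ * (∫ x, ζ x * A x ^ 2) + caccioppoliConst p K L M B / (4 * τ)
  have hbd : ∀ᶠ j in atTop, ∫⁻ x, ENNReal.ofReal (q j x) ≤ ENNReal.ofReal R := by
    filter_upwards [tendsto_molRadius.eventually_le_const hr] with j hj
    have hne : s j • e ≠ 0 := by
      rw [← norm_ne_zero_iff, norm_smul, he, mul_one]; exact (norm_pos_iff.2 (hs0 j).ne').ne'
    have hn : ‖s j • e‖ = s j := by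
      rw [norm_smul, he, mul_one, Real.norm_of_nonneg (hs0 j).le]
    have h1 := hs.integral_weight_mul_mollify_increment_le hp hL hM hζ hζS hS hr
      (h := s j • e) (by rw [hn]; exact hj) hne hk hA hA0 hAa hτ
    rw [hn] at h1
    have hqe : ∀ x, q j x = (s j)⁻¹ * (ζ x * (A x * ‖mollify k G (x + s j • e) -
        mollify k G x‖)) := by
      intro x
      simp only [hqdef, norm_smul, Real.norm_of_nonneg (inv_nonneg.2 (hs0 j).le)]
      ring
    have hqi : Integrable (q j) := by
      refine ((hζ.integrable.mul_bdd (c := a * ((s j)⁻¹ * (2 * K ^ (p / 2))))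
        (g := fun x => A x * ‖(s j)⁻¹ • (mollify k G (x + s j • e) - mollify k G x)‖) ?_
        (Eventually.of_forall fun x => ?_)))
      · exact (hA.mul (hcs j).measurable).aestronglyMeasurable
      · rw [norm_mul, norm_norm, norm_smul, Real.norm_of_nonneg (hA0 x),
          Real.norm_of_nonneg (inv_nonneg.2 (hs0 j).le)]
        have := hs0 j
        have := norm_increment_le (norm_mollify_le k hGb) (x + s j • e) x
        have := (hA0 x).trans (hAa x)
        gcongr
        exact hAa x
    rw [← ofReal_integral_eq_lintegral_ofReal hqi (Eventually.of_forall (hq0 j))]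
    apply ENNReal.ofReal_le_ofReal
    simp only [hqe]
    rw [integral_const_mul, inv_mul_le_iff₀ (hs0 j)]
    exact h1
  have hfat : ∫⁻ x, ENNReal.ofReal (ζ x * (A x * ‖fderiv ℝ (mollify k G) x e‖)) ≤
      ENNReal.ofReal R := by
    calc _ = ∫⁻ x, liminf (fun j => ENNReal.ofReal (q j x)) atTop := by
          congr 1; ext x
          exact ((ENNReal.continuous_ofReal.tendsto _).comp (hlim x)).liminf_eq.symm
      _ ≤ liminf (fun j => ∫⁻ x, ENNReal.ofReal (q j x)) atTop :=
          lintegral_liminf_le fun j => (hqm j).ennreal_ofReal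
      _ ≤ _ := liminf_le_of_frequently_le' hbd.frequently
  have hR : 0 ≤ R := by
    have h1 : 0 ≤ ∫ x, ζ x * A x ^ 2 :=
      integral_nonneg fun x => mul_nonneg (hζ.nonneg x) (sq_nonneg _)
    have hK := hs.nonneg_K
    have hB := hζ.nonneg_bound
    have h2 : 0 ≤ caccioppoliConst p K L M B := by unfold caccioppoliConst; positivity
    positivity
  have h0 : 0 ≤ᵐ[volume] fun x => ζ x * (A x * ‖fderiv ℝ (mollify k G) x e‖) :=
    Eventually.of_forall fun x => mul_nonneg (hζ.nonneg x) (mul_nonneg (hA0 x) (norm_nonneg _))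
  rw [← ofReal_integral_eq_lintegral_ofReal hint h0] at hfat
  exact (ENNReal.ofReal_le_ofReal_iff hR).1 hfat

end BoundedSolution

/-! ### Testing the equation with functions of G -/

namespace BoundedSolution

variable {n : ℕ} {W : Set (Sp n)} {p K L M : ℝ} {u : Sp n → ℝ} {D : Sp n → Sp n} {F : Sp n → ℝ}
  {S : Set (Sp n)} {r B : ℝ} {ζ Θ : Sp n → ℝ} {k : ℕ}

/-- Reduces the full derivative to the n coordinate directions, the source of the factor n in later
constants. -/
lemma norm_apply_le_sum {E' : Type*} [NormedAddCommGroup E'] [NormedSpace ℝ E']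
    (T : Sp n →L[ℝ] E') (v : Sp n) :
    ‖T v‖ ≤ ∑ i, ‖v‖ * ‖T (EuclideanSpace.basisFun (Fin n) ℝ i)‖ := by
  conv_lhs => rw [← (EuclideanSpace.basisFun (Fin n) ℝ).sum_repr v, map_sum]
  refine (norm_sum_le _ _).trans (Finset.sum_le_sum fun i _ => ?_)
  rw [map_smul, norm_smul]
  gcongr
  rw [EuclideanSpace.basisFun_repr]
  exact PiLp.norm_apply_le v i

lemma integrable_testing_terms (hs : BoundedSolution W p K L M u D F) (hp : 2 ≤ p)
    (hζ : AdmissibleWeight ζ Θ B) {Ψ : Sp n → ℝ} {P₀ P₁ : ℝ}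
    (hΨ : ContDiff ℝ ∞ Ψ) (hΨ0 : ∀ g, 0 ≤ Ψ g) (hP₀ : ∀ g, Ψ g ≤ P₀)
    (hP₁ : ∀ g, ‖fderiv ℝ Ψ g‖ ≤ P₁) {g : Sp n → Sp n} (hg : Measurable g) :
    Integrable (fun x => ζ x * Ψ (g x)) ∧
    Integrable (fun x => ‖fderiv ℝ ζ x‖ * ‖H (p - 1) (D x)‖ * Ψ (g x)) ∧
    Integrable (fun x => ζ x * (‖H (p - 1) (D x)‖ * ‖fderiv ℝ Ψ (g x)‖) ^ 2) := by
  have hK := hs.nonneg_K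
  have hΨm : Measurable fun x => Ψ (g x) := hΨ.continuous.measurable.comp hg
  have hDm : Measurable fun x => ‖fderiv ℝ Ψ (g x)‖ :=
    ((hΨ.continuous_fderiv (by simp)).norm.measurable).comp hg
  have hVm : Measurable fun x => ‖H (p - 1) (D x)‖ := (hs.measurable_H_comp _).norm
  have hVb := hs.norm_H_comp_le (q := p - 1) (by linarith)
  have hζd : Integrable fun x => ‖fderiv ℝ ζ x‖ :=
    ((hζ.contDiff.continuous_fderiv (by simp)).integrable_of_hasCompactSupport
      (hζ.compact.fderiv ℝ)).norm
  have hΨb : ∀ᵐ x, ‖Ψ (g x)‖ ≤ P₀ := Eventually.of_forall fun x => by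
    rw [Real.norm_of_nonneg (hΨ0 _)]; exact hP₀ _
  refine ⟨hζ.integrable.mul_bdd hΨm.aestronglyMeasurable hΨb,
    (hζd.mul_bdd (c := K ^ (p - 1)) hVm.aestronglyMeasurable
      (Eventually.of_forall fun x => by rw [norm_norm]; exact hVb x)).mul_bdd
      hΨm.aestronglyMeasurable hΨb,
    hζ.integrable.mul_bdd (c := (K ^ (p - 1) * P₁) ^ 2)
      ((hVm.mul hDm).pow_const 2).aestronglyMeasurable (Eventually.of_forall fun x => ?_)⟩
  rw [norm_pow, norm_mul, norm_norm, norm_norm]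
  gcongr
  · exact hVb x
  · exact hP₁ _

/-- The test function is ζ Ψ(G_k). By the chain rule the derivative of G_k appears once, multiplied
by ζ |H_{p-1}(Du)| |DΨ(G_k)|, and the previous estimate applies in each coordinate direction. The
bounds P₀ and P₁ serve integrability only. -/
lemma integral_testing_mollify_le (hs : BoundedSolution W p K L M u D F) (hp : 2 ≤ p)
    (hL : 0 ≤ L) (hM : 0 ≤ M) (hζ : AdmissibleWeight ζ Θ B) (hζS : tsupport ζ ⊆ S)
    (hS : ∀ x ∈ S, Metric.closedBall x (3 * r) ⊆ W) (hr : 0 < r) (hk : molRadius k ≤ r)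
    {c₁ : ℝ} (hF : ∀ᵐ x, x ∈ W → c₁ ≤ F x) {Ψ : Sp n → ℝ} {P₀ P₁ τ : ℝ}
    (hΨ : ContDiff ℝ ∞ Ψ) (hΨ0 : ∀ g, 0 ≤ Ψ g) (hP₀ : ∀ g, Ψ g ≤ P₀)
    (hP₁ : ∀ g, ‖fderiv ℝ Ψ g‖ ≤ P₁) (hτ : 0 < τ) :
    ∫ x, (c₁ * (ζ x * Ψ (mollify k (fun y => H (p / 2) (D y)) x)) -
        ‖fderiv ℝ ζ x‖ * ‖H (p - 1) (D x)‖ * Ψ (mollify k (fun y => H (p / 2) (D y)) x) -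
        n * τ * (ζ x * (‖H (p - 1) (D x)‖ *
          ‖fderiv ℝ Ψ (mollify k (fun y => H (p / 2) (D y)) x)‖) ^ 2)) ≤
      n * (caccioppoliConst p K L M B / (4 * τ)) := by
  set G : Sp n → Sp n := fun y => H (p / 2) (D y) with hG
  have hGm : Measurable G := hs.measurable_H_comp _
  have hGb : ∀ x, ‖G x‖ ≤ K ^ (p / 2) := hs.norm_H_comp_le (by linarith)
  have hsm := contDiff_mollify k hGm hGb
  set A : Sp n → ℝ := fun x => ‖H (p - 1) (D x)‖ * ‖fderiv ℝ Ψ (mollify k G x)‖ with hAdef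
  have hA0 : ∀ x, 0 ≤ A x := fun x => by positivity
  have hAm : Measurable A := (hs.measurable_H_comp _).norm.mul
    (((hΨ.continuous_fderiv (by simp)).norm.measurable).comp hsm.continuous.measurable)
  have hK := hs.nonneg_K
  have hVb := hs.norm_H_comp_le (q := p - 1) (by linarith)
  have hAa : ∀ x, A x ≤ K ^ (p - 1) * P₁ := fun x => by
    simp only [hAdef]
    gcongr
    · exact hVb x
    · exact hP₁ _
  obtain ⟨i1, i2, i3⟩ := hs.integrable_testing_terms hp hζ hΨ hΨ0 hP₀ hP₁
    hsm.continuous.measurable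
  have hSW : S ⊆ W := fun x hx => hS x hx (Metric.mem_closedBall_self (by linarith))
  have hφ : IsTestFun W (fun x => ζ x * Ψ (mollify k G x)) :=
    ⟨hζ.contDiff.mul (hΨ.comp hsm), hζ.compact.mul_right,
      (tsupport_mul_subset_left (f := ζ) (g := fun x => Ψ (mollify k G x))).trans
        (hζS.trans hSW)⟩
  have hfd : ∀ x, fderiv ℝ (fun x => ζ x * Ψ (mollify k G x)) x (H (p - 1) (D x)) ≤
      ‖fderiv ℝ ζ x‖ * ‖H (p - 1) (D x)‖ * Ψ (mollify k G x) +
      ∑ i, ζ x * (A x * ‖fderiv ℝ (mollify k G) x (EuclideanSpace.basisFun (Fin n) ℝ i)‖) := by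
    intro x
    have hd1 := hζ.contDiff.differentiable (by simp) x
    have hd2 := hsm.differentiable (by simp) x
    have hd3 := hΨ.differentiable (by simp) (mollify k G x)
    have hc : HasFDerivAt (fun x => Ψ (mollify k G x))
        ((fderiv ℝ Ψ (mollify k G x)).comp (fderiv ℝ (mollify k G) x)) x :=
      hd3.hasFDerivAt.comp x hd2.hasFDerivAt
    rw [(hd1.hasFDerivAt.fun_mul hc).fderiv]
    simp only [add_apply, smul_apply, smul_eq_mul, ContinuousLinearMap.comp_apply]
    have hz := hζ.nonneg x
    set v := H (p - 1) (D x)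
    have e1 : fderiv ℝ ζ x v ≤ ‖fderiv ℝ ζ x‖ * ‖v‖ :=
      (le_abs_self _).trans ((fderiv ℝ ζ x).le_opNorm v)
    have e2 : fderiv ℝ Ψ (mollify k G x) (fderiv ℝ (mollify k G) x v) ≤
        ∑ i, A x * ‖fderiv ℝ (mollify k G) x (EuclideanSpace.basisFun (Fin n) ℝ i)‖ := by
      refine (le_abs_self _).trans (((fderiv ℝ Ψ (mollify k G x)).le_opNorm _).trans ?_)
      refine (mul_le_mul_of_nonneg_left (norm_apply_le_sum _ v) (norm_nonneg _)).trans_eq ?_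
      rw [Finset.mul_sum]
      refine Finset.sum_congr rfl fun i _ => ?_
      simp only [hAdef]
      ring
    have e3 := mul_le_mul_of_nonneg_left e2 hz
    have e4 := mul_le_mul_of_nonneg_left e1 (hΨ0 (mollify k G x))
    rw [Finset.mul_sum] at e3
    linarith
  have hder := fun i => hs.integral_weight_mul_fderiv_mollify_le hp hL hM hζ hζS hS hr hk hAm hA0
    hAa hτ (e := EuclideanSpace.basisFun (Fin n) ℝ i) ((EuclideanSpace.basisFun (Fin n) ℝ).norm_eq_one i)
  have hlow : c₁ * ∫ x, ζ x * Ψ (mollify k G x) ≤ ∫ x, F x * (ζ x * Ψ (mollify k G x)) := by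
    rw [← integral_const_mul]
    refine integral_mono_ae (i1.const_mul _) (hs.integrable_rhs _ hφ) ?_
    filter_upwards [hF] with x hx
    by_cases hxs : x ∈ tsupport ζ
    · exact mul_le_mul_of_nonneg_right (hx (hSW (hζS hxs))) (mul_nonneg (hζ.nonneg x) (hΨ0 _))
    · simp [image_eq_zero_of_notMem_tsupport hxs]
  have hup : ∫ x, fderiv ℝ (fun x => ζ x * Ψ (mollify k G x)) x (H (p - 1) (D x)) ≤
      (∫ x, ‖fderiv ℝ ζ x‖ * ‖H (p - 1) (D x)‖ * Ψ (mollify k G x)) +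
      ∑ i : Fin n, (τ * (∫ x, ζ x * A x ^ 2) + caccioppoliConst p K L M B / (4 * τ)) := by
    have isum := integrable_finsetSum (Finset.univ : Finset (Fin n)) fun i _ => (hder i).1
    refine (integral_mono (hφ.integrable_fderiv_apply (hs.measurable_H_comp _) hVb)
      (i2.add isum) hfd).trans ?_
    simp only [Pi.add_apply]
    rw [integral_add i2 isum, integral_finsetSum _ fun i _ => (hder i).1]
    gcongr with i
    exact (hder i).2
  rw [hs.eq _ hφ] at hup
  have i4 : Integrable fun x => c₁ * (ζ x * Ψ (mollify k G x)) -
      ‖fderiv ℝ ζ x‖ * ‖H (p - 1) (D x)‖ * Ψ (mollify k G x) := (i1.const_mul _).sub i2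
  rw [integral_sub i4 (i3.const_mul _), integral_sub (i1.const_mul _) i2,
    integral_const_mul, integral_const_mul]
  rw [Finset.sum_const, Finset.card_univ, Fintype.card_fin, nsmul_eq_mul] at hup
  linarith

/-- The derivative of the mollified G no longer occurs, so k → ∞ needs only almost everywhere
convergence of its values. -/
theorem integral_testing_le (hs : BoundedSolution W p K L M u D F) (hp : 2 ≤ p)
    (hL : 0 ≤ L) (hM : 0 ≤ M) (hζ : AdmissibleWeight ζ Θ B) (hζS : tsupport ζ ⊆ S)
    (hS : ∀ x ∈ S, Metric.closedBall x (3 * r) ⊆ W) (hr : 0 < r)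
    {c₁ : ℝ} (hc₁ : 0 < c₁) (hF : ∀ᵐ x, x ∈ W → c₁ ≤ F x) {Ψ : Sp n → ℝ} {P₀ P₁ τ : ℝ}
    (hΨ : ContDiff ℝ ∞ Ψ) (hΨ0 : ∀ g, 0 ≤ Ψ g) (hP₀ : ∀ g, Ψ g ≤ P₀)
    (hP₁ : ∀ g, ‖fderiv ℝ Ψ g‖ ≤ P₁) (hτ : 0 < τ) :
    ∫ x, (c₁ * (ζ x * Ψ (H (p / 2) (D x))) -
        ‖fderiv ℝ ζ x‖ * ‖H (p - 1) (D x)‖ * Ψ (H (p / 2) (D x)) -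
        n * τ * (ζ x * (‖H (p - 1) (D x)‖ * ‖fderiv ℝ Ψ (H (p / 2) (D x))‖) ^ 2)) ≤
      n * (caccioppoliConst p K L M B / (4 * τ)) := by
  set G : Sp n → Sp n := fun y => H (p / 2) (D y) with hG
  have hGm : Measurable G := hs.measurable_H_comp _
  have hGb : ∀ x, ‖G x‖ ≤ K ^ (p / 2) := hs.norm_H_comp_le (by linarith)
  have hK := hs.nonneg_K
  have hVb := hs.norm_H_comp_le (q := p - 1) (by linarith)
  have hζd : Integrable fun x => ‖fderiv ℝ ζ x‖ :=
    ((hζ.contDiff.continuous_fderiv (by simp)).integrable_of_hasCompactSupport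
      (hζ.compact.fderiv ℝ)).norm
  have hbound : Integrable fun x => c₁ * P₀ * ζ x + K ^ (p - 1) * P₀ * ‖fderiv ℝ ζ x‖ +
      n * τ * (K ^ (p - 1) * P₁) ^ 2 * ζ x :=
    ((hζ.integrable.const_mul _).add (hζd.const_mul _)).add (hζ.integrable.const_mul _)
  have hlim := tendsto_integral_of_dominated_convergence (μ := (volume : Measure (Sp n)))
    (F := fun k x => c₁ * (ζ x * Ψ (mollify k G x)) -
        ‖fderiv ℝ ζ x‖ * ‖H (p - 1) (D x)‖ * Ψ (mollify k G x) -
        n * τ * (ζ x * (‖H (p - 1) (D x)‖ * ‖fderiv ℝ Ψ (mollify k G x)‖) ^ 2))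
    (f := fun x => c₁ * (ζ x * Ψ (G x)) -
        ‖fderiv ℝ ζ x‖ * ‖H (p - 1) (D x)‖ * Ψ (G x) -
        n * τ * (ζ x * (‖H (p - 1) (D x)‖ * ‖fderiv ℝ Ψ (G x)‖) ^ 2))
    _ (fun k => ?_) hbound (fun k => Eventually.of_forall fun x => ?_) ?_
  · refine le_of_tendsto hlim ?_
    filter_upwards [tendsto_molRadius.eventually_le_const hr] with k hk
    exact hs.integral_testing_mollify_le hp hL hM hζ hζS hS hr hk hF hΨ hΨ0 hP₀ hP₁ hτ
  · obtain ⟨i1, i2, i3⟩ := hs.integrable_testing_terms hp hζ hΨ hΨ0 hP₀ hP₁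
      (contDiff_mollify k hGm hGb).continuous.measurable
    exact (((i1.const_mul _).sub i2).sub (i3.const_mul _)).aestronglyMeasurable
  · have hz := hζ.nonneg x
    set y := mollify k G x
    have h0 := hΨ0 y
    have a1 : ‖c₁ * (ζ x * Ψ y)‖ ≤ c₁ * P₀ * ζ x := by
      rw [Real.norm_of_nonneg (by positivity)]
      have := mul_le_mul_of_nonneg_left (hP₀ y) (by positivity : 0 ≤ c₁ * ζ x)
      linarith
    have a2 : ‖‖fderiv ℝ ζ x‖ * ‖H (p - 1) (D x)‖ * Ψ y‖ ≤ K ^ (p - 1) * P₀ * ‖fderiv ℝ ζ x‖ := by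
      rw [Real.norm_of_nonneg (by positivity)]
      calc _ ≤ ‖fderiv ℝ ζ x‖ * K ^ (p - 1) * P₀ := by
            gcongr
            · exact hVb x
            · exact hP₀ y
        _ = _ := by ring
    have a3 : ‖n * τ * (ζ x * (‖H (p - 1) (D x)‖ * ‖fderiv ℝ Ψ y‖) ^ 2)‖ ≤
        n * τ * (K ^ (p - 1) * P₁) ^ 2 * ζ x := by
      rw [Real.norm_of_nonneg (by positivity)]
      calc _ ≤ n * τ * (ζ x * (K ^ (p - 1) * P₁) ^ 2) := by
            gcongr
            · exact hVb x
            · exact hP₁ y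
        _ = _ := by ring
    refine (norm_sub_le _ _).trans (add_le_add ((norm_sub_le _ _).trans (add_le_add a1 a2)) a3)
  · filter_upwards [ae_tendsto_mollify hGm hGb] with x hx
    have h1 := (hΨ.continuous.tendsto _).comp hx
    have h2 := ((hΨ.continuous_fderiv (by simp)).norm.tendsto _).comp hx
    exact (((h1.const_mul _).const_mul _).sub (h1.const_mul _)).sub
      ((((h2.const_mul _).pow 2).const_mul _).const_mul _)

end BoundedSolution

/-! ### Regularized negative powers -/

section RegularizedPower

variable {n : ℕ}

/-- The regularization `(κ + |g|²)^{-t}` of `|g|^{-2t}`. -/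
def regPow (κ t : ℝ) (g : Sp n) : ℝ := (κ + ‖g‖ ^ 2) ^ (-t)

variable {κ t : ℝ}

lemma regPow_base_pos (hκ : 0 < κ) (g : Sp n) : 0 < κ + ‖g‖ ^ 2 := by positivity

lemma regPow_nonneg (hκ : 0 < κ) (g : Sp n) : 0 ≤ regPow κ t g :=
  Real.rpow_nonneg (regPow_base_pos hκ g).le _

lemma contDiff_regPow (hκ : 0 < κ) : ContDiff ℝ ∞ (regPow κ t : Sp n → ℝ) :=
  (contDiff_const.add (contDiff_norm_sq ℝ)).rpow_const_of_ne fun g => (regPow_base_pos hκ g).ne'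

lemma regPow_le (hκ : 0 < κ) (ht : 0 ≤ t) (g : Sp n) : regPow κ t g ≤ κ ^ (-t) :=
  Real.rpow_le_rpow_of_nonpos hκ (by have := sq_nonneg ‖g‖; linarith) (by linarith)

lemma norm_le_base_rpow (hκ : 0 < κ) (g : Sp n) : ‖g‖ ≤ (κ + ‖g‖ ^ 2) ^ (1 / 2 : ℝ) := by
  rw [← Real.sqrt_eq_rpow]
  exact Real.le_sqrt_of_sq_le (by linarith)

lemma norm_fderiv_regPow_le' (hκ : 0 < κ) (ht : 0 ≤ t) (g : Sp n) :
    ‖fderiv ℝ (regPow κ t) g‖ ≤ 2 * t * (κ + ‖g‖ ^ 2) ^ (-t - 1) * ‖g‖ := by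
  have hX := regPow_base_pos hκ g
  have h1 : HasFDerivAt (fun g : Sp n => κ + ‖g‖ ^ 2) (2 • innerSL ℝ g) g :=
    (hasStrictFDerivAt_norm_sq g).hasFDerivAt.const_add κ
  have h2 := h1.rpow_const (p := -t) (Or.inl hX.ne')
  have h3 : fderiv ℝ (regPow κ t) g = (-t * (κ + ‖g‖ ^ 2) ^ (-t - 1)) • 2 • innerSL ℝ g :=
    h2.fderiv
  rw [h3, norm_smul, ← Nat.cast_smul_eq_nsmul ℝ, norm_smul, innerSL_apply_norm, norm_mul, norm_neg,
    Real.norm_of_nonneg ht, Real.norm_of_nonneg (Real.rpow_nonneg hX.le _)]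
  norm_num
  apply le_of_eq
  ring

lemma norm_fderiv_regPow_le (hκ : 0 < κ) (ht : 0 ≤ t) (g : Sp n) :
    ‖fderiv ℝ (regPow κ t) g‖ ≤ 2 * t * (κ + ‖g‖ ^ 2) ^ (-t - 1 / 2) := by
  have hX := regPow_base_pos hκ g
  refine (norm_fderiv_regPow_le' hκ ht g).trans ?_
  calc _ ≤ 2 * t * (κ + ‖g‖ ^ 2) ^ (-t - 1) * (κ + ‖g‖ ^ 2) ^ (1 / 2 : ℝ) := by
        gcongr
        exact norm_le_base_rpow hκ g
    _ = _ := by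
        rw [mul_assoc, ← Real.rpow_add hX]
        congr 2; ring

lemma norm_fderiv_regPow_le_const (hκ : 0 < κ) (ht : 0 ≤ t) (g : Sp n) :
    ‖fderiv ℝ (regPow κ t) g‖ ≤ 2 * t * κ ^ (-t - 1 / 2) := by
  refine (norm_fderiv_regPow_le hκ ht g).trans ?_
  refine mul_le_mul_of_nonneg_left ?_ (by linarith)
  exact Real.rpow_le_rpow_of_nonpos hκ (by have := sq_nonneg ‖g‖; linarith) (by linarith)

lemma norm_H_eq_mul {p : ℝ} (hp : 2 ≤ p) (ξ : Sp n) :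
    ‖H (p - 1) ξ‖ = ‖H (p / 2) ξ‖ ^ ((p - 2) / p) * ‖H (p / 2) ξ‖ := by
  rw [H_eq_smul_H_half hp, norm_smul, Real.norm_of_nonneg (by positivity)]

lemma norm_H_le_base_rpow {p : ℝ} (hp : 2 ≤ p) (hκ : 0 < κ) (ξ : Sp n) :
    ‖H (p - 1) ξ‖ ≤ (κ + ‖H (p / 2) ξ‖ ^ 2) ^ ((p - 1) / p) := by
  rw [norm_H_eq_mul hp]
  set g := H (p / 2) ξ
  have hX := regPow_base_pos hκ g
  have h1 := norm_le_base_rpow hκ g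
  have hq : 0 ≤ (p - 2) / p := div_nonneg (by linarith) (by linarith)
  calc _ ≤ ((κ + ‖g‖ ^ 2) ^ (1 / 2 : ℝ)) ^ ((p - 2) / p) * (κ + ‖g‖ ^ 2) ^ (1 / 2 : ℝ) := by
        gcongr
    _ = _ := by
        rw [← Real.rpow_mul hX.le, ← Real.rpow_add hX]
        congr 1
        field_simp
        ring

variable {p Y : ℝ}

lemma norm_H_mul_regPow_le (hp : 2 ≤ p) (ht : t ≤ (p - 2) / p) (hκ : 0 < κ) {ξ : Sp n}
    (hY : κ + ‖H (p / 2) ξ‖ ^ 2 ≤ Y) :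
    ‖H (p - 1) ξ‖ * regPow κ t (H (p / 2) ξ) ≤ Y ^ ((p - 1) / p - t) := by
  have hX := regPow_base_pos hκ (H (p / 2) ξ)
  have he : 0 ≤ (p - 1) / p - t := by
    have : (p - 2) / p ≤ (p - 1) / p := by gcongr; linarith
    linarith
  calc _ ≤ (κ + ‖H (p / 2) ξ‖ ^ 2) ^ ((p - 1) / p) * regPow κ t (H (p / 2) ξ) := by
        have := regPow_nonneg (t := t) hκ (H (p / 2) ξ)
        gcongr
        exact norm_H_le_base_rpow hp hκ ξ
    _ = (κ + ‖H (p / 2) ξ‖ ^ 2) ^ ((p - 1) / p - t) := by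
        rw [regPow, ← Real.rpow_add hX, ← sub_eq_add_neg]
    _ ≤ _ := by gcongr

/-- With X = κ + |G|², the left side is at most 4t² X^{2(p-1)/p - 2t - 1} = 4t² X^{(p-2)/p - t}
X^{-t}. The hypothesis t ≤ (p-2)/p makes the first exponent nonnegative, so the bound is uniform in
κ. -/
lemma norm_H_mul_fderiv_regPow_sq_le (hp : 2 ≤ p) (ht0 : 0 ≤ t) (ht : t ≤ (p - 2) / p)
    (hκ : 0 < κ) {ξ : Sp n} (hY : κ + ‖H (p / 2) ξ‖ ^ 2 ≤ Y) :
    (‖H (p - 1) ξ‖ * ‖fderiv ℝ (regPow κ t) (H (p / 2) ξ)‖) ^ 2 ≤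
      4 * t ^ 2 * Y ^ ((p - 2) / p - t) * regPow κ t (H (p / 2) ξ) := by
  set g := H (p / 2) ξ
  have hX := regPow_base_pos hκ g
  have he : 0 ≤ (p - 2) / p - t := by linarith
  calc _ ≤ ((κ + ‖g‖ ^ 2) ^ ((p - 1) / p) * (2 * t * (κ + ‖g‖ ^ 2) ^ (-t - 1 / 2))) ^ 2 := by
        gcongr
        · exact norm_H_le_base_rpow hp hκ ξ
        · exact norm_fderiv_regPow_le hκ ht0 g
    _ = 4 * t ^ 2 * (κ + ‖g‖ ^ 2) ^ ((p - 2) / p - t) * (κ + ‖g‖ ^ 2) ^ (-t) := by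
        rw [mul_left_comm, ← Real.rpow_add hX, mul_pow, ← Real.rpow_natCast ((κ + ‖g‖ ^ 2) ^ _) 2,
          ← Real.rpow_mul hX.le, mul_assoc (4 * t ^ 2), ← Real.rpow_add hX]
        rw [show ((p - 1) / p + (-t - 1 / 2)) * ((2 : ℕ) : ℝ) = (p - 2) / p - t + -t by
          push_cast; field_simp; ring]
        ring
    _ ≤ _ := by
        rw [regPow]
        gcongr

end RegularizedPower

/-! ### Weighted bound for negative powers of G, and nullity of its zero set -/

namespace BoundedSolution

variable {n : ℕ} {W : Set (Sp n)} {p K L M : ℝ} {u : Sp n → ℝ} {D : Sp n → Sp n} {F : Sp n → ℝ}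
  {S : Set (Sp n)} {r B : ℝ} {ζ Θ : Sp n → ℝ}

/-- The constant in the bound for the weighted integral of `(κ + |H_{p/2}(Du)|²)^{-t}`. -/
def weightConst (n : ℕ) (p t K L M B c₁ : ℝ) : ℝ :=
  2 / c₁ * ((1 + (K ^ (p / 2)) ^ 2) ^ ((p - 1) / p - t) * B +
    n * (caccioppoliConst p K L M B / (4 * (c₁ / (2 * (n + 1) *
      (4 * t ^ 2 * (1 + (K ^ (p / 2)) ^ 2) ^ ((p - 2) / p - t) + 1))))))

theorem integral_weight_regPow_le (hs : BoundedSolution W p K L M u D F) (hp : 2 ≤ p)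
    (hL : 0 ≤ L) (hM : 0 ≤ M) (hζ : AdmissibleWeight ζ Θ B) (hζS : tsupport ζ ⊆ S)
    (hS : ∀ x ∈ S, Metric.closedBall x (3 * r) ⊆ W) (hr : 0 < r)
    {c₁ : ℝ} (hc₁ : 0 < c₁) (hF : ∀ᵐ x, x ∈ W → c₁ ≤ F x) {t κ : ℝ} (ht0 : 0 ≤ t)
    (ht : t ≤ (p - 2) / p) (hκ : 0 < κ) (hκ1 : κ ≤ 1) :
    Integrable (fun x => ζ x * regPow κ t (H (p / 2) (D x))) ∧
    ∫ x, ζ x * regPow κ t (H (p / 2) (D x)) ≤ weightConst n p t K L M B c₁ := by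
  have hK := hs.nonneg_K
  set Y := 1 + (K ^ (p / 2)) ^ 2 with hYdef
  have hY : ∀ x, κ + ‖H (p / 2) (D x)‖ ^ 2 ≤ Y := fun x => by
    have := hs.norm_H_comp_le (q := p / 2) (by linarith) x
    simp only [hYdef]
    gcongr
  have hY0 : 0 < Y := by positivity
  set C₂ := Y ^ ((p - 1) / p - t) with hC₂
  set C₃ := 4 * t ^ 2 * Y ^ ((p - 2) / p - t) with hC₃
  have hC₂0 : 0 ≤ C₂ := by positivity
  have hC₃0 : 0 ≤ C₃ := by positivity
  -- Chosen so that nτC₃ ≤ c₁/2, which absorbs the quadratic term; adding 1 keeps the denominator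
  -- positive even if n or C₃ is 0.
  set τ := c₁ / (2 * (n + 1) * (C₃ + 1)) with hτdef
  have hτ : 0 < τ := by positivity
  have hτC : n * τ * C₃ ≤ c₁ / 2 := by
    have e : n * τ * C₃ = c₁ / 2 * (n / (n + 1) * (C₃ / (C₃ + 1))) := by
      rw [hτdef]; field_simp
    rw [e]
    have h1 : (n : ℝ) / (n + 1) ≤ 1 := by rw [div_le_one (by positivity)]; linarith
    have h2 : C₃ / (C₃ + 1) ≤ 1 := by rw [div_le_one (by positivity)]; linarith
    have h3 : (n : ℝ) / (n + 1) * (C₃ / (C₃ + 1)) ≤ 1 := mul_le_one₀ h1 (by positivity) h2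
    exact mul_le_of_le_one_right (by positivity) h3
  have key := hs.integral_testing_le hp hL hM hζ hζS hS hr hc₁ hF (contDiff_regPow (t := t) hκ)
    (regPow_nonneg hκ) (regPow_le hκ ht0) (norm_fderiv_regPow_le_const hκ ht0) hτ
  obtain ⟨i1, i2, i3⟩ := hs.integrable_testing_terms hp hζ (contDiff_regPow (t := t) hκ)
    (regPow_nonneg hκ) (regPow_le hκ ht0) (norm_fderiv_regPow_le_const hκ ht0)
    (hs.measurable_H_comp (p / 2))
  have hlow : ∀ x, c₁ / 2 * (ζ x * regPow κ t (H (p / 2) (D x))) - C₂ / 2 * (ζ x + Θ x) ≤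
      c₁ * (ζ x * regPow κ t (H (p / 2) (D x))) -
        ‖fderiv ℝ ζ x‖ * ‖H (p - 1) (D x)‖ * regPow κ t (H (p / 2) (D x)) -
        n * τ * (ζ x * (‖H (p - 1) (D x)‖ * ‖fderiv ℝ (regPow κ t) (H (p / 2) (D x))‖) ^ 2) := by
    intro x
    have hz := hζ.nonneg x
    have hΘ := hζ.nonneg_dom x
    -- Arithmetic-geometric mean applied to |Dζ|² ≤ ζ Θ; this bounds ∫ |Dζ| by B.
    have b1 : ‖fderiv ℝ ζ x‖ ≤ (ζ x + Θ x) / 2 := by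
      refine le_of_sq_le_sq ?_ (by positivity)
      have := hζ.sq_le x
      nlinarith [sq_nonneg (ζ x - Θ x)]
    have b2 := norm_H_mul_regPow_le hp ht hκ (hY x)
    have b3 := norm_H_mul_fderiv_regPow_sq_le hp ht0 ht hκ (hY x)
    have b4 : ‖fderiv ℝ ζ x‖ * (‖H (p - 1) (D x)‖ * regPow κ t (H (p / 2) (D x))) ≤
        (ζ x + Θ x) / 2 * C₂ := by
      have := regPow_nonneg (t := t) hκ (H (p / 2) (D x))
      gcongr
    have b5 := mul_le_mul_of_nonneg_left b3 (by positivity : 0 ≤ n * τ * ζ x)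
    have b6 : n * τ * C₃ * (ζ x * regPow κ t (H (p / 2) (D x))) ≤
        c₁ / 2 * (ζ x * regPow κ t (H (p / 2) (D x))) :=
      mul_le_mul_of_nonneg_right hτC (mul_nonneg hz (regPow_nonneg hκ _))
    linarith
  refine ⟨i1, ?_⟩
  have i4 : Integrable fun x => C₂ / 2 * (ζ x + Θ x) :=
    (hζ.integrable.add hζ.integrable_dom).const_mul _
  have key2 := (integral_mono ((i1.const_mul (c₁ / 2)).sub i4)
    (((i1.const_mul c₁).sub i2).sub (i3.const_mul (n * τ))) hlow).trans key
  simp only [Pi.sub_apply] at key2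
  rw [integral_sub (i1.const_mul (c₁ / 2)) i4, integral_const_mul, integral_const_mul,
    integral_add hζ.integrable hζ.integrable_dom] at key2
  have h1 := mul_le_mul_of_nonneg_left (add_le_add hζ.integral_le hζ.integral_dom_le)
    (by positivity : 0 ≤ C₂ / 2)
  have h2 : c₁ / 2 * ∫ x, ζ x * regPow κ t (H (p / 2) (D x)) ≤
      C₂ * B + n * (caccioppoliConst p K L M B / (4 * τ)) := by linarith
  have h3 := mul_le_mul_of_nonneg_left h2 (by positivity : 0 ≤ 2 / c₁)
  have e : 2 / c₁ * (c₁ / 2 * ∫ x, ζ x * regPow κ t (H (p / 2) (D x))) =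
      ∫ x, ζ x * regPow κ t (H (p / 2) (D x)) := by field_simp
  rw [e] at h3
  exact h3

/-- For ψ = κ/(κ + |g|²) one has |g| |Dψ(g)| ≤ 2ψ(g) for all κ, and |H_{p-1}| contains one full
factor |g|. -/
lemma norm_H_mul_fderiv_scaled_le (hp : 2 ≤ p) {κ R : ℝ} (hκ : 0 < κ) {ξ : Sp n}
    (hR : ‖H (p / 2) ξ‖ ≤ R) :
    ‖H (p - 1) ξ‖ * ‖fderiv ℝ (fun g => κ * regPow κ 1 g) (H (p / 2) ξ)‖ ≤
      2 * R ^ ((p - 2) / p) * (κ * regPow κ 1 (H (p / 2) ξ)) := by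
  set g := H (p / 2) ξ
  have hX := regPow_base_pos hκ g
  have hq : 0 ≤ (p - 2) / p := div_nonneg (by linarith) (by linarith)
  have hR0 := (norm_nonneg _).trans hR
  rw [norm_H_eq_mul hp, fderiv_const_mul ((contDiff_regPow hκ).differentiable (by simp) g),
    norm_smul, Real.norm_of_nonneg hκ.le]
  calc _ ≤ (R ^ ((p - 2) / p) * ‖g‖) * (κ * (2 * 1 * (κ + ‖g‖ ^ 2) ^ (-1 - 1 : ℝ) * ‖g‖)) := by
        gcongr
        exact norm_fderiv_regPow_le' hκ zero_le_one g
    _ = 2 * R ^ ((p - 2) / p) * (κ * ((κ + ‖g‖ ^ 2) ^ (-1 - 1 : ℝ) * ‖g‖ ^ 2)) := by ring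
    _ ≤ 2 * R ^ ((p - 2) / p) * (κ * ((κ + ‖g‖ ^ 2) ^ (-1 - 1 : ℝ) * (κ + ‖g‖ ^ 2))) := by
        gcongr
        linarith
    _ = _ := by
        rw [regPow, ← Real.rpow_add_one hX.ne']
        norm_num

lemma tendsto_scaled_regPow (g : Sp n) :
    Tendsto (fun j => molRadius j * regPow (molRadius j) 1 g) atTop
      (𝓝 (if g = 0 then 1 else 0)) := by
  split_ifs with h
  · refine tendsto_const_nhds.congr fun j => ?_
    have := molRadius_pos j
    simp [regPow, h, Real.rpow_neg_one, this.ne']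
  · have hg : (0 : ℝ) + ‖g‖ ^ 2 ≠ 0 := by simpa using h
    have h1 := tendsto_molRadius.mul ((tendsto_molRadius.add_const (‖g‖ ^ 2)).inv₀ hg)
    rw [zero_mul] at h1
    refine h1.congr fun j => ?_
    rw [regPow, Real.rpow_neg_one]

/-- In the testing inequality with ψ_j → 1_{G=0}, the terms carrying H_{p-1}(Du) tend to 0
everywhere: on {G = 0} the field vanishes, elsewhere ψ_j → 0. Only the term with 1/τ survives. -/
theorem integral_weight_degenerate_le (hs : BoundedSolution W p K L M u D F) (hp : 2 ≤ p)
    (hL : 0 ≤ L) (hM : 0 ≤ M) (hζ : AdmissibleWeight ζ Θ B) (hζS : tsupport ζ ⊆ S)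
    (hS : ∀ x ∈ S, Metric.closedBall x (3 * r) ⊆ W) (hr : 0 < r)
    {c₁ : ℝ} (hc₁ : 0 < c₁) (hF : ∀ᵐ x, x ∈ W → c₁ ≤ F x) :
    ∫ x, ζ x * (if H (p / 2) (D x) = 0 then 1 else 0) ≤ 0 := by
  have hK := hs.nonneg_K
  set G : Sp n → Sp n := fun x => H (p / 2) (D x) with hG
  set ψ : ℕ → Sp n → ℝ := fun j g => molRadius j * regPow (molRadius j) 1 g with hψ
  have hr0 := molRadius_pos
  have hψ0 : ∀ j g, 0 ≤ ψ j g := fun j g =>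
    mul_nonneg (hr0 j).le (regPow_nonneg (hr0 j) g)
  have hψ1 : ∀ j g, ψ j g ≤ 1 := fun j g => by
    have := mul_le_mul_of_nonneg_left (regPow_le (hr0 j) zero_le_one g) (hr0 j).le
    rwa [Real.rpow_neg_one, mul_inv_cancel₀ (hr0 j).ne'] at this
  have hψs : ∀ j, ContDiff ℝ ∞ (ψ j) := fun j => contDiff_const.mul (contDiff_regPow (hr0 j))
  have hψd : ∀ j g, ‖fderiv ℝ (ψ j) g‖ ≤
      molRadius j * (2 * 1 * molRadius j ^ (-1 - 1 / 2 : ℝ)) := fun j g => by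
    rw [hψ]
    simp only
    rw [fderiv_const_mul ((contDiff_regPow (hr0 j)).differentiable (by simp) g), norm_smul,
      Real.norm_of_nonneg (hr0 j).le]
    exact mul_le_mul_of_nonneg_left (norm_fderiv_regPow_le_const (hr0 j) zero_le_one g) (hr0 j).le
  have hGb : ∀ x, ‖G x‖ ≤ K ^ (p / 2) := hs.norm_H_comp_le (by linarith)
  have hVb := hs.norm_H_comp_le (q := p - 1) (by linarith)
  have hVd : ∀ j x, ‖H (p - 1) (D x)‖ * ‖fderiv ℝ (ψ j) (G x)‖ ≤
      2 * (K ^ (p / 2)) ^ ((p - 2) / p) * ψ j (G x) := fun j x =>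
    norm_H_mul_fderiv_scaled_le hp (hr0 j) (hGb x)
  set R := 2 * (K ^ (p / 2)) ^ ((p - 2) / p) with hR
  have hR0 : 0 ≤ R := by positivity
  have hζd : Integrable fun x => ‖fderiv ℝ ζ x‖ :=
    ((hζ.contDiff.continuous_fderiv (by simp)).integrable_of_hasCompactSupport
      (hζ.compact.fderiv ℝ)).norm
  have hV0 : ∀ x, G x = 0 → ‖H (p - 1) (D x)‖ = 0 := fun x hx => by
    rw [norm_H_eq_mul hp]
    simp only [hG] at hx
    simp [hx]
  have key : ∀ τ : ℝ, 0 < τ → c₁ * ∫ x, ζ x * (if G x = 0 then 1 else 0) ≤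
      n * (caccioppoliConst p K L M B / (4 * τ)) := by
    intro τ hτ
    have hbound : Integrable fun x => c₁ * ζ x + K ^ (p - 1) * ‖fderiv ℝ ζ x‖ +
        n * τ * R ^ 2 * ζ x :=
      ((hζ.integrable.const_mul _).add (hζd.const_mul _)).add (hζ.integrable.const_mul _)
    have hlim := tendsto_integral_of_dominated_convergence (μ := (volume : Measure (Sp n)))
      (F := fun j x => c₁ * (ζ x * ψ j (G x)) -
          ‖fderiv ℝ ζ x‖ * ‖H (p - 1) (D x)‖ * ψ j (G x) -
          n * τ * (ζ x * (‖H (p - 1) (D x)‖ * ‖fderiv ℝ (ψ j) (G x)‖) ^ 2))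
      (f := fun x => c₁ * (ζ x * (if G x = 0 then 1 else 0)))
      _ (fun j => ?_) hbound (fun j => Eventually.of_forall fun x => ?_) ?_
    · rw [← integral_const_mul]
      refine le_of_tendsto' hlim fun j => ?_
      exact hs.integral_testing_le hp hL hM hζ hζS hS hr hc₁ hF (hψs j) (hψ0 j) (hψ1 j) (hψd j) hτ
    · obtain ⟨i1, i2, i3⟩ := hs.integrable_testing_terms hp hζ (hψs j) (hψ0 j) (hψ1 j) (hψd j)
        (hs.measurable_H_comp (p / 2))
      exact (((i1.const_mul _).sub i2).sub (i3.const_mul _)).aestronglyMeasurable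
    · have hz := hζ.nonneg x
      have h0 := hψ0 j (G x)
      have h1 := hψ1 j (G x)
      have a1 : ‖c₁ * (ζ x * ψ j (G x))‖ ≤ c₁ * ζ x := by
        rw [Real.norm_of_nonneg (by positivity)]
        gcongr
        exact mul_le_of_le_one_right hz h1
      have a2 : ‖‖fderiv ℝ ζ x‖ * ‖H (p - 1) (D x)‖ * ψ j (G x)‖ ≤
          K ^ (p - 1) * ‖fderiv ℝ ζ x‖ := by
        rw [Real.norm_of_nonneg (by positivity)]
        refine (mul_le_of_le_one_right (by positivity) h1).trans ?_
        rw [mul_comm]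
        gcongr
        exact hVb x
      have a3 : ‖n * τ * (ζ x * (‖H (p - 1) (D x)‖ * ‖fderiv ℝ (ψ j) (G x)‖) ^ 2)‖ ≤
          n * τ * R ^ 2 * ζ x := by
        rw [Real.norm_of_nonneg (by positivity)]
        calc _ ≤ n * τ * (ζ x * R ^ 2) := by
              gcongr
              exact (hVd j x).trans (mul_le_of_le_one_right hR0 h1)
          _ = _ := by ring
      exact (norm_sub_le _ _).trans (add_le_add ((norm_sub_le _ _).trans (add_le_add a1 a2)) a3)
    · refine Eventually.of_forall fun x => ?_
      have h1 := tendsto_scaled_regPow (G x)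
      by_cases hx : G x = 0
      · have hv := hV0 x hx
        simp only [hv, mul_zero, zero_mul, sub_zero, ne_eq, OfNat.ofNat_ne_zero,
          not_false_eq_true, zero_pow]
        exact (h1.const_mul _).const_mul _
      · simp only [hx, if_false] at h1 ⊢
        have h2 : Tendsto (fun j => ‖H (p - 1) (D x)‖ * ‖fderiv ℝ (ψ j) (G x)‖) atTop (𝓝 0) := by
          refine squeeze_zero (fun j => by positivity) (fun j => hVd j x) ?_
          simpa using h1.const_mul R
        have h3 := (((h1.const_mul (ζ x)).const_mul c₁).sub
          (h1.const_mul (‖fderiv ℝ ζ x‖ * ‖H (p - 1) (D x)‖))).sub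
            (((h2.pow 2).const_mul (ζ x)).const_mul (n * τ))
        simpa using h3
  -- Nothing has to be absorbed here, so τ may be taken arbitrarily large.
  have hlim : Tendsto (fun τ : ℝ => n * (caccioppoliConst p K L M B / (4 * τ))) atTop (𝓝 0) := by
    have h1 : Tendsto (fun τ : ℝ => caccioppoliConst p K L M B / (4 * τ)) atTop (𝓝 0) :=
      tendsto_const_nhds.div_atTop (tendsto_id.const_mul_atTop (by norm_num))
    simpa using h1.const_mul (n : ℝ)
  have h := ge_of_tendsto hlim ((eventually_gt_atTop 0).mono key)
  exact nonpos_of_mul_nonpos_right h hc₁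

end BoundedSolution

/-! ### Cutoffs and singular weights -/

section Weights

variable {n : ℕ}

lemma exists_cutoff {Q W : Set (Sp n)} (hQ : IsCompact Q) (hW : IsOpen W) (hQW : Q ⊆ W) :
    ∃ η : Sp n → ℝ, ContDiff ℝ ∞ η ∧ HasCompactSupport η ∧ tsupport η ⊆ W ∧
      (∀ y ∈ Q, η y = 1) ∧ ∀ y, η y ∈ Icc (0 : ℝ) 1 := by
  obtain ⟨Q', hQ', hQQ', hQ'W⟩ := exists_compact_between hQ hW hQW
  obtain ⟨f, hf1, hf0, hf⟩ := exists_contMDiffMap_one_nhds_of_subset_interior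
    (modelWithCornersSelf ℝ (Sp n)) (n := ⊤) hQ.isClosed hQQ'
  have hts : tsupport f ⊆ Q' :=
    closure_minimal (fun x hx => by_contra fun hx' => hx (hf0 x hx')) hQ'.isClosed
  exact ⟨f, f.contMDiff.contDiff, hQ'.of_isClosed_subset (isClosed_tsupport _) hts,
    hts.trans hQ'W, fun y hy => (hf1.filter_mono (nhds_le_nhdsSet hy)).self_of_nhds, hf⟩

/-- The integral of `|z|^{-a}` over the unit ball. -/
def ballIntegral (n : ℕ) (a : ℝ) : ℝ := ∫ z in Metric.ball (0 : Sp n) 1, ‖z‖ ^ (-a)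

lemma integrableOn_ball_rpow [NeZero n] {a : ℝ} (ha : a < n) :
    IntegrableOn (fun z : Sp n => ‖z‖ ^ (-a)) (Metric.ball 0 1) := by
  have hn : 1 ≤ n := Nat.one_le_iff_ne_zero.2 (NeZero.ne n)
  have : Nontrivial (Sp n) := by
    have : Nonempty (Fin n) := ⟨⟨0, hn⟩⟩
    infer_instance
  refine (integrableOn_fun_norm_addHaar volume (f := fun r : ℝ => r ^ (-a))).2 ?_
  rw [finrank_euclideanSpace_fin]
  have h1 : IntegrableOn (fun y : ℝ => y ^ ((n : ℝ) - 1 - a)) (Ioo 0 1) :=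
    (intervalIntegral.integrableOn_Ioo_rpow_iff zero_lt_one).2 (by linarith)
  refine h1.congr_fun (fun y hy => ?_) measurableSet_Ioo
  simp only [smul_eq_mul]
  rw [← Real.rpow_natCast, ← Real.rpow_add hy.1, Nat.cast_sub hn]
  congr 1
  push_cast
  ring

lemma ballIntegral_nonneg (a : ℝ) : 0 ≤ ballIntegral n a :=
  setIntegral_nonneg measurableSet_ball fun z _ => Real.rpow_nonneg (norm_nonneg z) _

/-- The regularized kernel is at most |y - x|^{-a}, integrable on the unit ball about x and at most
1 outside it. Hence the bound is uniform in x and δ. -/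
lemma setIntegral_regPow_le [NeZero n] {a δ : ℝ} (ha0 : 0 ≤ a) (ha : a < n) (hδ : 0 < δ)
    {Q : Set (Sp n)} (hQ : IsCompact Q) (x : Sp n) :
    ∫ y in Q, regPow δ (a / 2) (y - x) ≤ volume.real Q + ballIntegral n a := by
  have hn : 1 ≤ n := Nat.one_le_iff_ne_zero.2 (NeZero.ne n)
  have : Nontrivial (Sp n) := by
    have : Nonempty (Fin n) := ⟨⟨0, hn⟩⟩
    infer_instance
  set s : Sp n → ℝ := (Metric.ball (0 : Sp n) 1).indicator fun z => ‖z‖ ^ (-a) with hs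
  have hsi : Integrable s := (integrable_indicator_iff measurableSet_ball).2 (integrableOn_ball_rpow ha)
  have hs0 : ∀ z, 0 ≤ s z := fun z =>
    indicator_nonneg (fun z _ => Real.rpow_nonneg (norm_nonneg z) _) z
  have hsx : Integrable fun y => s (y - x) := hsi.comp_sub_right x
  have h1 : IntegrableOn (fun _ : Sp n => (1 : ℝ)) Q := integrableOn_const hQ.measure_lt_top.ne
  have hle : ∀ᵐ y ∂(volume.restrict Q), regPow δ (a / 2) (y - x) ≤ 1 + s (y - x) := by
    refine ae_restrict_of_ae ?_
    have hne : ∀ᵐ y : Sp n, y ≠ x := by simp [ae_iff, measure_singleton]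
    filter_upwards [hne] with y hy
    have hyx : 0 < ‖y - x‖ := norm_pos_iff.2 (sub_ne_zero.2 hy)
    have hb : regPow δ (a / 2) (y - x) ≤ ‖y - x‖ ^ (-a) := by
      have : ‖y - x‖ ^ (-a) = (‖y - x‖ ^ 2) ^ (-(a / 2)) := by
        rw [← Real.rpow_natCast, ← Real.rpow_mul hyx.le]
        congr 1; push_cast; ring
      rw [this, regPow]
      exact Real.rpow_le_rpow_of_nonpos (by positivity) (by linarith) (by linarith)
    by_cases h : ‖y - x‖ < 1
    · have : s (y - x) = ‖y - x‖ ^ (-a) := indicator_of_mem (by simpa using h) _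
      linarith
    · have : ‖y - x‖ ^ (-a) ≤ 1 :=
        Real.rpow_le_one_of_one_le_of_nonpos (not_lt.1 h) (by linarith)
      linarith [hs0 (y - x)]
  have hcont : Continuous fun y => regPow δ (a / 2) (y - x) :=
    (contDiff_regPow hδ).continuous.comp (continuous_sub_right x)
  refine (integral_mono_ae (hcont.continuousOn.integrableOn_compact hQ)
    (h1.add hsx.integrableOn) hle).trans ?_
  simp only [Pi.add_apply]
  rw [integral_add h1 hsx.integrableOn]
  refine add_le_add (by simp) ?_
  refine (setIntegral_le_integral hsx (Eventually.of_forall fun y => hs0 _)).trans_eq ?_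
  rw [integral_sub_right_eq_self s x, hs, integral_indicator measurableSet_ball]
  rfl

/-- Squaring the cutoff leaves a factor η² in |D(η²)|², and the regularized kernels satisfy |Dρ_γ|²
≤ γ² ρ_γ ρ_{γ+2}; so the weight itself factors out. -/
lemma sq_norm_fderiv_singular_weight_le {η : Sp n → ℝ} (hη : ContDiff ℝ ∞ η) {γ δ : ℝ}
    (hγ : 0 ≤ γ) (hδ : 0 < δ) (x y : Sp n) :
    ‖fderiv ℝ (fun y => η y ^ 2 * regPow δ (γ / 2) (y - x)) y‖ ^ 2 ≤
      η y ^ 2 * regPow δ (γ / 2) (y - x) *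
        (8 * ‖fderiv ℝ η y‖ ^ 2 * regPow δ (γ / 2) (y - x) +
          2 * γ ^ 2 * (η y ^ 2 * regPow δ ((γ + 2) / 2) (y - x))) := by
  have hX := regPow_base_pos hδ (y - x)
  set ρ := regPow δ (γ / 2) (y - x) with hρ
  have hρ0 : 0 ≤ ρ := regPow_nonneg hδ _
  have hd1 : HasFDerivAt η (fderiv ℝ η y) y := (hη.differentiable (by simp) y).hasFDerivAt
  have hd2 : HasFDerivAt (fun y => regPow δ (γ / 2) (y - x))
      (fderiv ℝ (regPow δ (γ / 2)) (y - x)) y := by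
    have := ((contDiff_regPow (t := γ / 2) hδ).differentiable (by simp) (y - x)).hasFDerivAt.comp y
      ((hasFDerivAt_id y).sub_const x)
    simpa [Function.comp_def] using this
  have hd := ((hd1.pow 2).fun_mul hd2).fderiv
  rw [hd]
  set dη := fderiv ℝ η y
  set dρ := fderiv ℝ (regPow δ (γ / 2)) (y - x)
  have hdρ : ‖dρ‖ ^ 2 ≤ γ ^ 2 * (ρ * regPow δ ((γ + 2) / 2) (y - x)) := by
    have h1 := norm_fderiv_regPow_le hδ (by linarith : 0 ≤ γ / 2) (y - x)
    calc ‖dρ‖ ^ 2 ≤ (2 * (γ / 2) * (δ + ‖y - x‖ ^ 2) ^ (-(γ / 2) - 1 / 2)) ^ 2 := by gcongr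
      _ = γ ^ 2 * (δ + ‖y - x‖ ^ 2) ^ (-(γ / 2) + -((γ + 2) / 2)) := by
          rw [mul_pow, ← Real.rpow_natCast ((δ + ‖y - x‖ ^ 2) ^ _) 2, ← Real.rpow_mul hX.le]
          congr 1
          · ring
          · congr 1; push_cast; ring
      _ = _ := by rw [Real.rpow_add hX]; rfl
  have hn : ‖η y ^ 2 • dρ + ρ • (2 • η y ^ (2 - 1)) • dη‖ ≤
      η y ^ 2 * ‖dρ‖ + 2 * (|η y| * (ρ * ‖dη‖)) := by
    refine (norm_add_le _ _).trans (add_le_add ?_ ?_)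
    · rw [norm_smul, Real.norm_of_nonneg (sq_nonneg _)]
    · rw [norm_smul, norm_smul, Real.norm_of_nonneg hρ0]
      simp only [Nat.add_one_sub_one, pow_one, nsmul_eq_mul, Nat.cast_ofNat, norm_mul,
        Real.norm_ofNat, Real.norm_eq_abs]
      apply le_of_eq; ring
  calc _ ≤ (η y ^ 2 * ‖dρ‖ + 2 * (|η y| * (ρ * ‖dη‖))) ^ 2 := by gcongr
    _ ≤ 2 * (η y ^ 2 * ‖dρ‖) ^ 2 + 2 * (2 * (|η y| * (ρ * ‖dη‖))) ^ 2 := by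
        nlinarith [sq_nonneg (η y ^ 2 * ‖dρ‖ - 2 * (|η y| * (ρ * ‖dη‖)))]
    _ = 2 * (η y ^ 2) ^ 2 * ‖dρ‖ ^ 2 + 8 * (η y ^ 2 * (ρ ^ 2 * ‖dη‖ ^ 2)) := by
        rw [← sq_abs (η y)]; ring
    _ ≤ 2 * (η y ^ 2) ^ 2 * (γ ^ 2 * (ρ * regPow δ ((γ + 2) / 2) (y - x))) +
        8 * (η y ^ 2 * (ρ ^ 2 * ‖dη‖ ^ 2)) := by gcongr
    _ = _ := by ring

/-- The bound for the integrals of the singular weights with cutoff supported in `Q`. -/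
def singularBound (Q : Set (Sp n)) (E γ : ℝ) : ℝ :=
  (1 + 8 * E ^ 2) * (volume.real Q + ballIntegral n γ) +
    2 * γ ^ 2 * (volume.real Q + ballIntegral n (γ + 2))

lemma integral_le_of_support {Q : Set (Sp n)} (hQ : IsCompact Q) {f g : Sp n → ℝ}
    (hf : Continuous f) (hg : Continuous g) (hfQ : ∀ y ∉ Q, f y = 0) (hfg : ∀ y, f y ≤ g y) :
    ∫ y, f y ≤ ∫ y in Q, g y := by
  rw [← setIntegral_eq_integral_of_forall_compl_eq_zero hfQ]
  exact setIntegral_mono (hf.continuousOn.integrableOn_compact hQ)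
    (hg.continuousOn.integrableOn_compact hQ) hfg

lemma admissibleWeight_singular [NeZero n] {η : Sp n → ℝ} (hη : ContDiff ℝ ∞ η)
    (hηc : HasCompactSupport η) (hη01 : ∀ y, η y ∈ Icc (0 : ℝ) 1) {E : ℝ}
    (hE : ∀ y, ‖fderiv ℝ η y‖ ≤ E) {γ δ : ℝ} (hγ : 0 ≤ γ) (hγn : γ < n)
    (hγ2 : γ = 0 ∨ γ + 2 < n) (hδ : 0 < δ) (x : Sp n) :
    AdmissibleWeight (fun y => η y ^ 2 * regPow δ (γ / 2) (y - x))
      (fun y => 8 * ‖fderiv ℝ η y‖ ^ 2 * regPow δ (γ / 2) (y - x) +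
        2 * γ ^ 2 * (η y ^ 2 * regPow δ ((γ + 2) / 2) (y - x)))
      (singularBound (tsupport η) E γ) := by
  have hρ : ∀ s, ContDiff ℝ ∞ fun y => regPow δ s (y - x) := fun s =>
    (contDiff_regPow hδ).comp (contDiff_id.sub contDiff_const)
  have hρ0 : ∀ s y, 0 ≤ regPow δ s (y - x) := fun s y => regPow_nonneg hδ _
  have hdη : Continuous fun y => ‖fderiv ℝ η y‖ := (hη.continuous_fderiv (by simp)).norm
  have hE0 : 0 ≤ E := (norm_nonneg _).trans (hE 0)
  have hJ := fun a => ballIntegral_nonneg (n := n) a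
  have hη0 : ∀ y ∉ tsupport η, η y = 0 := fun y hy => image_eq_zero_of_notMem_tsupport hy
  have hdη0 : ∀ y ∉ tsupport η, fderiv ℝ η y = 0 := fun y hy =>
    image_eq_zero_of_notMem_tsupport fun h => hy (tsupport_fderiv_subset ℝ h)
  have hη1 : ∀ y, η y ^ 2 ≤ 1 := fun y => pow_le_one₀ (hη01 y).1 (hη01 y).2
  have I1 := setIntegral_regPow_le hγ hγn hδ (hηc : IsCompact (tsupport η)) x
  have hΘ1 : Continuous fun y => 8 * ‖fderiv ℝ η y‖ ^ 2 * regPow δ (γ / 2) (y - x) :=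
    (continuous_const.mul (hdη.pow 2)).mul (hρ _).continuous
  have hΘ2 : Continuous fun y => 2 * γ ^ 2 * (η y ^ 2 * regPow δ ((γ + 2) / 2) (y - x)) :=
    continuous_const.mul ((hη.continuous.pow 2).mul (hρ _).continuous)
  have hc1 : HasCompactSupport fun y => 8 * ‖fderiv ℝ η y‖ ^ 2 * regPow δ (γ / 2) (y - x) :=
    HasCompactSupport.intro hηc fun y hy => by simp [hdη0 y hy]
  have hc2 : HasCompactSupport fun y => 2 * γ ^ 2 * (η y ^ 2 * regPow δ ((γ + 2) / 2) (y - x)) :=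
    HasCompactSupport.intro hηc fun y hy => by simp [hη0 y hy]
  have hi1 := hΘ1.integrable_of_hasCompactSupport (μ := volume) hc1
  have hi2 := hΘ2.integrable_of_hasCompactSupport (μ := volume) hc2
  have hv : 0 ≤ volume.real (tsupport η) := measureReal_nonneg
  refine ⟨(hη.pow 2).mul (hρ _), HasCompactSupport.intro hηc fun y hy => by simp [hη0 y hy],
    fun y => mul_nonneg (sq_nonneg _) (hρ0 _ y), fun y => ?_,
    fun y => sq_norm_fderiv_singular_weight_le hη hγ hδ x y, hi1.add hi2, ?_, ?_⟩
  · have := hρ0 (γ / 2) y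
    have := hρ0 ((γ + 2) / 2) y
    positivity
  · refine (integral_le_of_support hηc ((hη.continuous.pow 2).mul (hρ _).continuous)
      (hρ (γ / 2)).continuous (fun y hy => by simp [hη0 y hy])
      (fun y => mul_le_of_le_one_left (hρ0 _ y) (hη1 y))).trans (I1.trans ?_)
    have h1 := hJ γ
    have h2 := hJ (γ + 2)
    have h3 : 0 ≤ 8 * E ^ 2 * (volume.real (tsupport η) + ballIntegral n γ) := by positivity
    have h4 : 0 ≤ 2 * γ ^ 2 * (volume.real (tsupport η) + ballIntegral n (γ + 2)) := by positivity
    unfold singularBound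
    linarith
  · rw [integral_add hi1 hi2]
    have h1 : ∫ y, 8 * ‖fderiv ℝ η y‖ ^ 2 * regPow δ (γ / 2) (y - x) ≤
        8 * E ^ 2 * (volume.real (tsupport η) + ballIntegral n γ) := by
      refine (integral_le_of_support hηc hΘ1 (g := fun y => 8 * E ^ 2 * regPow δ (γ / 2) (y - x))
        (continuous_const.mul (hρ _).continuous)
        (fun y hy => by simp [hdη0 y hy]) (fun y => ?_)).trans ?_
      · have := hρ0 (γ / 2) y
        have := hE y
        gcongr
      · rw [integral_const_mul]
        gcongr
    have h2 : ∫ y, 2 * γ ^ 2 * (η y ^ 2 * regPow δ ((γ + 2) / 2) (y - x)) ≤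
        2 * γ ^ 2 * (volume.real (tsupport η) + ballIntegral n (γ + 2)) := by
      -- For γ = 0 the factor γ² removes the kernel of order γ + 2, which need not be integrable (n
      -- = 2).
      rcases hγ2 with rfl | h2
      · simp
      · rw [integral_const_mul]
        refine mul_le_mul_of_nonneg_left ?_ (by positivity)
        refine (integral_le_of_support hηc ((hη.continuous.pow 2).mul (hρ _).continuous)
          (hρ ((γ + 2) / 2)).continuous (fun y hy => by simp [hη0 y hy])
          (fun y => mul_le_of_le_one_left (hρ0 _ y) (hη1 y))).trans ?_
        exact setIntegral_regPow_le (by linarith) h2 hδ hηc x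
    have h3 := hJ γ
    unfold singularBound
    linarith

end Weights

/-! ### Reduction to globally bounded representatives -/

section Reduction

variable {n : ℕ}

/-- Setting the function to 0 where its norm exceeds K changes it only on a null set within W and
gives a bound on the whole space, as the mollifications require. -/
lemma exists_bounded_representative {E' : Type*} [NormedAddCommGroup E'] [MeasurableSpace E']
    [BorelSpace E'] {W : Set (Sp n)} (hW : MeasurableSet W) {g : Sp n → E'}
    {K : ℝ} (hK : 0 ≤ K) (hg : AEStronglyMeasurable g (volume.restrict W))
    (hgK : eLpNorm g ∞ (volume.restrict W) ≤ ENNReal.ofReal K) :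
    ∃ g₀ : Sp n → E', Measurable g₀ ∧ (∀ x, ‖g₀ x‖ ≤ K) ∧ ∀ᵐ x, x ∈ W → g₀ x = g x := by
  have hmk : StronglyMeasurable (hg.mk g) := hg.stronglyMeasurable_mk
  refine ⟨{x | ‖hg.mk g x‖ ≤ K}.indicator (hg.mk g),
    hmk.measurable.indicator (measurableSet_le hmk.norm.measurable measurable_const),
    fun x => ?_, ?_⟩
  · by_cases hx : x ∈ {x | ‖hg.mk g x‖ ≤ K}
    · rw [indicator_of_mem hx]; exact hx
    · rw [indicator_of_notMem hx, norm_zero]; exact hK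
  · rw [← ae_restrict_iff' hW]
    filter_upwards [hg.ae_eq_mk, ae_le_eLpNormEssSup (f := g) (μ := volume.restrict W)]
      with x hx1 hx2
    rw [← eLpNorm_exponent_top] at hx2
    have hx3 : ‖g x‖ ≤ K := by
      have := hx2.trans hgK
      rwa [← ofReal_norm, ENNReal.ofReal_le_ofReal_iff hK] at this
    rw [indicator_of_mem (by rw [mem_ofPred_eq, ← hx1]; exact hx3), hx1]

lemma IsTestFun.memW10 {U : Set (Sp n)} {φ : Sp n → ℝ} (hφ : IsTestFun U φ) (q : ℝ≥0∞) :
    MemW10 U q φ (gradient φ) := by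
  have hc : Continuous (gradient φ) :=
    (LinearIsometryEquiv.continuous _).comp (hφ.1.continuous_fderiv (by simp))
  have hcs : HasCompactSupport (gradient φ) :=
    (hφ.2.1.fderiv ℝ).comp_left (g := (InnerProductSpace.toDual ℝ (Sp n)).symm) (map_zero _)
  refine ⟨hφ.1.continuous.memLp_of_hasCompactSupport hφ.2.1, hc.memLp_of_hasCompactSupport hcs,
    fun _ => φ, fun _ => hφ, ?_, ?_⟩ <;> simp

lemma IsTestFun.mono {U V : Set (Sp n)} {φ : Sp n → ℝ} (hφ : IsTestFun U φ) (h : U ⊆ V) :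
    IsTestFun V φ := ⟨hφ.1, hφ.2.1, hφ.2.2.trans h⟩

lemma IsTestFun.eq_zero {U : Set (Sp n)} {φ : Sp n → ℝ} (hφ : IsTestFun U φ) {x : Sp n}
    (hx : x ∉ U) : φ x = 0 :=
  image_eq_zero_of_notMem_tsupport fun h => hx (hφ.2.2 h)

lemma IsTestFun.fderiv_eq_zero {U : Set (Sp n)} {φ : Sp n → ℝ} (hφ : IsTestFun U φ) {x : Sp n}
    (hx : x ∉ U) : fderiv ℝ φ x = 0 :=
  image_eq_zero_of_notMem_tsupport fun h => hx (hφ.2.2 (tsupport_fderiv_subset ℝ h))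

lemma CompactlyIn.subset {U V : Set (Sp n)} (h : CompactlyIn U V) : U ⊆ V :=
  subset_closure.trans h.2

lemma exists_compactlyIn_between {Q Ω : Set (Sp n)} (hQ : IsCompact Q) (hΩ : IsOpen Ω)
    (hQΩ : Q ⊆ Ω) : ∃ U, IsOpen U ∧ CompactlyIn U Ω ∧ Q ⊆ U := by
  obtain ⟨Q', hQ', h1, h2⟩ := exists_compact_between hQ hΩ hQΩ
  have h3 : closure (interior Q') ⊆ Q' := closure_minimal interior_subset hQ'.isClosed
  exact ⟨interior Q', isOpen_interior,
    ⟨hQ'.of_isClosed_subset isClosed_closure h3, h3.trans h2⟩, h1⟩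

lemma setIntegral_eq_of_ae_eq_of_eq_zero {W Ω : Set (Sp n)} (hWΩ : W ⊆ Ω) {a b : Sp n → ℝ}
    (ha : ∀ x ∉ W, a x = 0) (hb : ∀ x ∉ W, b x = 0) (hab : ∀ᵐ x, x ∈ W → b x = a x) :
    ∫ x in Ω, a x = ∫ x, b x := by
  rw [setIntegral_eq_integral_of_forall_compl_eq_zero fun x hx => ha x fun h => hx (hWΩ h)]
  refine integral_congr_ae ?_
  filter_upwards [hab] with x hx
  by_cases hxW : x ∈ W
  · exact (hx hxW).symm
  · rw [ha x hxW, hb x hxW]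

theorem exists_boundedSolution {Ω W : Set (Sp n)} (hW : IsOpen W) (hWΩ : CompactlyIn W Ω)
    {p K L M : ℝ} (hK : 0 < K) {f : Sp n → ℝ → ℝ} (hf : LipBounds f W K L M)
    {u : Sp n → ℝ} {Du : Sp n → Sp n} (hu : MemW1loc Ω ⊤ u Du)
    (hsol : IsLocalWeakSolution Ω p f u Du) (hKu : normW1inf W u Du ≤ ENNReal.ofReal K) :
    ∃ (u₀ : Sp n → ℝ) (D : Sp n → Sp n),
      BoundedSolution W p K L M u₀ D (fun x => f x (u x)) ∧
      (∀ᵐ x, x ∈ W → u₀ x = u x) ∧ ∀ᵐ x, x ∈ W → D x = Du x := by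
  obtain ⟨hm1, hm2⟩ := hu.2 W hW hWΩ
  obtain ⟨u₀, hu₀m, hu₀K, hu₀⟩ := exists_bounded_representative hW.measurableSet hK.le hm1.1
    (le_self_add.trans hKu)
  obtain ⟨D, hDm, hDK, hD⟩ := exists_bounded_representative hW.measurableSet hK.le hm2.1
    (le_add_self.trans hKu)
  have hsub := hWΩ.subset
  refine ⟨u₀, D, ⟨hu₀m, hDm, hu₀K, hDK, fun φ hφ v => ?_, fun φ hφ => ?_, fun φ hφ => ?_,
    fun h => ?_⟩, hu₀, hD⟩
  · have h1 := hu.1.2.2 φ (hφ.mono hsub) v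
    rw [setIntegral_eq_of_ae_eq_of_eq_zero hsub (b := fun x => u₀ x * fderiv ℝ φ x v)
        (fun x hx => by simp [hφ.fderiv_eq_zero hx]) (fun x hx => by simp [hφ.fderiv_eq_zero hx])
        (hu₀.mono fun x hx h => by rw [hx h]),
      setIntegral_eq_of_ae_eq_of_eq_zero hsub (b := fun x => φ x * inner ℝ (D x) v)
        (fun x hx => by simp [hφ.eq_zero hx]) (fun x hx => by simp [hφ.eq_zero hx])
        (hD.mono fun x hx h => by rw [hx h])] at h1
    exact h1
  · refine (integrableOn_iff_integrable_of_support_subset fun x hx => ?_).1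
      (hsol.2 W hW hWΩ φ _ (hφ.memW10 _)).2.1
    by_contra hxΩ
    exact hx (by simp [hφ.eq_zero fun h => hxΩ (hsub h)])
  · have h1 := (hsol.2 W hW hWΩ φ _ (hφ.memW10 _)).2.2
    have hinner : ∀ x v, inner ℝ v (gradient φ x) = fderiv ℝ φ x v := fun x v => by
      rw [real_inner_comm, inner_gradient_left]
    simp only [hinner] at h1
    rw [setIntegral_eq_of_ae_eq_of_eq_zero hsub
        (b := fun x => fderiv ℝ φ x (H (p - 1) (D x)))
        (fun x hx => by simp [hφ.fderiv_eq_zero hx]) (fun x hx => by simp [hφ.fderiv_eq_zero hx])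
        (hD.mono fun x hx h => by rw [hx h]),
      setIntegral_eq_of_ae_eq_of_eq_zero hsub (b := fun x => f x (u x) * φ x)
        (fun x hx => by simp [hφ.eq_zero hx]) (fun x hx => by simp [hφ.eq_zero hx])
        (Eventually.of_forall fun x _ => rfl)] at h1
    exact h1
  -- Translations preserve null sets, so u₀ = u also at x + h for almost every x with x + h in W;
  -- (F1) and (F2) may then be used with values bounded by K everywhere.
  · have hqmp := (measurePreserving_add_right (volume : Measure (Sp n)) h).quasiMeasurePreserving
    filter_upwards [hu₀, hqmp.ae hu₀] with x hx1 hx2 hxW hxhW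
    rw [← hx1 hxW, ← hx2 hxhW]
    have a1 := hf.2 (x + h) hxhW x hxW (u₀ (x + h)) (hu₀K _)
    have a2 := hf.1 x hxW (u₀ (x + h)) (u₀ x) (hu₀K _) (hu₀K _)
    rw [add_sub_cancel_left] at a1
    exact (abs_sub_le _ _ _).trans (add_le_add a1 a2)

/-- (F1) and (F2) make f jointly Lipschitz on the compact set closure W × [-K, K], where a positive
continuous function attains a positive minimum. A slightly larger open set is needed to cover the
closure. -/
lemma exists_pos_lower_bound {Ω W : Set (Sp n)} (hΩ : IsOpen Ω) (hWΩ : CompactlyIn W Ω)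
    {f : Sp n → ℝ → ℝ} (hpos : IsPositiveOn f Ω) (hf : SatisfiesF1F2 f Ω) {K : ℝ} (hK : 0 < K) :
    ∃ c₁ : ℝ, 0 < c₁ ∧ ∀ x ∈ W, ∀ s, |s| ≤ K → c₁ ≤ f x s := by
  rcases W.eq_empty_or_nonempty with rfl | ⟨x₀, hx₀⟩
  · exact ⟨1, one_pos, by simp⟩
  obtain ⟨U, hU, hUΩ, hWU⟩ := exists_compactlyIn_between hWΩ.1 hΩ hWΩ.2
  obtain ⟨L, M, hL, hM, hLM⟩ := hf U hU hUΩ K hK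
  have hlip : LipschitzOnWith (L + M).toNNReal (fun z : Sp n × ℝ => f z.1 z.2)
      (closure W ×ˢ Icc (-K) K) := by
    refine LipschitzOnWith.of_dist_le_mul fun z hz w hw => ?_
    have a1 := hLM.1 z.1 (hWU hz.1) z.2 w.2 (abs_le.2 hz.2) (abs_le.2 hw.2)
    have a2 := hLM.2 z.1 (hWU hz.1) w.1 (hWU hw.1) w.2 (abs_le.2 hw.2)
    have b1 : |z.2 - w.2| ≤ dist z w := (le_max_right _ _ : dist z.2 w.2 ≤ max _ _)
    have b2 : ‖z.1 - w.1‖ ≤ dist z w := by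
      rw [← dist_eq_norm]; exact (le_max_left _ _ : dist z.1 w.1 ≤ max _ _)
    rw [Real.coe_toNNReal _ (by positivity), Real.dist_eq]
    refine (abs_sub_le _ (f z.1 w.2) _).trans ?_
    have c1 := mul_le_mul_of_nonneg_left b1 hL.le
    have c2 := mul_le_mul_of_nonneg_left b2 hM.le
    linarith
  obtain ⟨z, hz, hmin⟩ := (hWΩ.1.prod isCompact_Icc).exists_isMinOn
    ⟨(x₀, 0), subset_closure hx₀, by simp [hK.le]⟩ hlip.continuousOn
  exact ⟨f z.1 z.2, hpos _ (hWΩ.2 hz.1) _,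
    fun x hx s hs => hmin (show (x, s) ∈ closure W ×ˢ Icc (-K) K from
      ⟨subset_closure hx, abs_le.1 hs⟩)⟩

lemma ae_le_rhs {W : Set (Sp n)} {p K L M : ℝ} {f : Sp n → ℝ → ℝ} {u u₀ : Sp n → ℝ}
    {D : Sp n → Sp n} {F : Sp n → ℝ} (hs : BoundedSolution W p K L M u₀ D F)
    (hu₀ : ∀ᵐ x, x ∈ W → u₀ x = u x) {c₁ : ℝ} (hc₁ : ∀ x ∈ W, ∀ s, |s| ≤ K → c₁ ≤ f x s) :
    ∀ᵐ x, x ∈ W → c₁ ≤ f x (u x) := by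
  filter_upwards [hu₀] with x hx hxW
  rw [← hx hxW]
  exact hc₁ x hxW _ (hs.bound_u x)

end Reduction

/-! ### The weight integral and the degeneracy set -/

section WeightIntegral

variable {n : ℕ}

lemma exists_compact_margin {Q W : Set (Sp n)} (hQ : IsCompact Q) (hW : IsOpen W) (hQW : Q ⊆ W) :
    ∃ r : ℝ, 0 < r ∧ ∀ x ∈ Q, Metric.closedBall x (3 * r) ⊆ W := by
  obtain ⟨δ, hδ, h⟩ := hQ.exists_cthickening_subset_open hW hQW
  refine ⟨δ / 3, by positivity, fun x hx => ?_⟩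
  rw [mul_div_cancel₀ _ (by norm_num : (3 : ℝ) ≠ 0)]
  exact (Metric.closedBall_subset_cthickening hx δ).trans h

lemma tendsto_ofReal_regPow (s : ℝ) (g : Sp n) :
    Tendsto (fun j => ENNReal.ofReal (regPow (molRadius j) s g)) atTop
      (𝓝 (ENNReal.ofReal (‖g‖ ^ 2) ^ (-s))) := by
  have h1 : Tendsto (fun j => ENNReal.ofReal (molRadius j + ‖g‖ ^ 2)) atTop
      (𝓝 (ENNReal.ofReal (‖g‖ ^ 2))) := by
    refine (ENNReal.continuous_ofReal.tendsto _).comp ?_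
    simpa using tendsto_molRadius.add_const (‖g‖ ^ 2)
  refine (((ENNReal.continuous_rpow_const (y := -s)).tendsto _).comp h1).congr fun j => ?_
  exact ENNReal.ofReal_rpow_of_pos (regPow_base_pos (molRadius_pos j) g)

lemma ofReal_norm_sq_rpow (γ : ℝ) (g : Sp n) :
    ENNReal.ofReal (‖g‖ ^ 2) ^ (-(γ / 2)) = ENNReal.ofReal ‖g‖ ^ (-γ) := by
  rw [ENNReal.ofReal_pow (norm_nonneg g), ← ENNReal.rpow_natCast, ← ENNReal.rpow_mul]
  congr 1
  push_cast
  ring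

lemma ofReal_norm_H_sq_rpow {p : ℝ} (hp : 2 ≤ p) (t : ℝ) (ξ : Sp n) :
    ENNReal.ofReal (‖H (p / 2) ξ‖ ^ 2) ^ (-t) = ENNReal.ofReal (‖ξ‖ - 1) ^ (-(p * t)) := by
  have h0 : (0 : ℝ) ≤ max (‖ξ‖ - 1) 0 := le_max_right _ _
  rw [norm_H (by linarith), ← Real.rpow_natCast, ← Real.rpow_mul h0,
    ← ENNReal.ofReal_rpow_of_nonneg h0 (by push_cast; linarith), ← ENNReal.rpow_mul,
    ENNReal.ofReal_max, ENNReal.ofReal_zero, max_eq_left zero_le]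
  congr 1
  push_cast
  ring

lemma rpow_neg_ofReal_ne_zero {a s : ℝ} (hs : 0 ≤ s) : ENNReal.ofReal a ^ (-s) ≠ 0 := by
  rw [Ne, ENNReal.rpow_eq_zero_iff]
  rintro (⟨-, h⟩ | ⟨h, -⟩)
  · linarith
  · exact ENNReal.ofReal_ne_top h

theorem exists_bound_weight_integral (hn : 2 ≤ n) {Ω' W : Set (Sp n)} (hΩ' : IsOpen Ω')
    (hW : IsOpen W) (hΩ'W : CompactlyIn Ω' W) {p t γ K L M c₁ : ℝ} (hp : 2 ≤ p) (ht0 : 0 ≤ t)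
    (ht : t ≤ (p - 2) / p) (hγ : 0 ≤ γ) (hγn : γ < n) (hγ2 : γ = 0 ∨ γ + 2 < n)
    (hL : 0 ≤ L) (hM : 0 ≤ M) (hc₁ : 0 < c₁) :
    ∃ C : ℝ, 0 < C ∧ ∀ (u : Sp n → ℝ) (D : Sp n → Sp n) (F : Sp n → ℝ),
      BoundedSolution W p K L M u D F → (∀ᵐ x, x ∈ W → c₁ ≤ F x) → ∀ x,
      ∫⁻ y in Ω', ENNReal.ofReal (‖D y‖ - 1) ^ (-(p * t)) * ENNReal.ofReal ‖x - y‖ ^ (-γ) ≤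
        ENNReal.ofReal C := by
  have : NeZero n := ⟨by omega⟩
  obtain ⟨η, hη, hηc, hηW, hη1, hη01⟩ := exists_cutoff hΩ'W.1 hW hΩ'W.2
  obtain ⟨r, hr, hrW⟩ := exists_compact_margin hηc hW hηW
  obtain ⟨E, hE⟩ := (hηc.fderiv ℝ).exists_bound_of_continuous (hη.continuous_fderiv (by simp))
  set B := singularBound (tsupport η) E γ
  -- The cutoff, the margin r and B are fixed before u, so the constant is uniform over all
  -- solutions and all x; the maximum with 1 only ensures positivity.
  refine ⟨max 1 (BoundedSolution.weightConst n p t K L M B c₁), by positivity, fun u D F hs hF x => ?_⟩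
  set C := max 1 (BoundedSolution.weightConst n p t K L M B c₁)
  have hr1 : ∀ j, molRadius j ≤ 1 := fun j => by
    unfold molRadius
    rw [div_le_one (by positivity)]
    linarith [Nat.cast_nonneg (α := ℝ) j]
  -- One parameter regularizes both the negative power of G and the kernel in x - y, so a single
  -- application of Fatou's lemma removes both.
  set q : ℕ → Sp n → ℝ := fun j y =>
    regPow (molRadius j) t (H (p / 2) (D y)) * regPow (molRadius j) (γ / 2) (y - x) with hq
  have hqm : ∀ j, Measurable (q j) := fun j =>
    ((contDiff_regPow (molRadius_pos j)).continuous.measurable.comp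
      (hs.measurable_H_comp _)).mul ((contDiff_regPow (molRadius_pos j)).continuous.measurable.comp
        (measurable_id.sub_const x))
  have hbd : ∀ j, ∫⁻ y in Ω', ENNReal.ofReal (q j y) ≤ ENNReal.ofReal C := by
    intro j
    have hw := admissibleWeight_singular hη hηc hη01 hE hγ hγn hγ2 (molRadius_pos j) x
    have hsupp : tsupport (fun y => η y ^ 2 * regPow (molRadius j) (γ / 2) (y - x)) ⊆
        tsupport η := by
      exact closure_mono fun y hy hy' => hy (by simp [show η y = 0 from hy'])
    obtain ⟨hint, hle⟩ := hs.integral_weight_regPow_le hp hL hM hw hsupp hrW hr hc₁ hF ht0 ht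
      (molRadius_pos j) (hr1 j)
    have h0 : ∀ y, 0 ≤ η y ^ 2 * regPow (molRadius j) (γ / 2) (y - x) *
        regPow (molRadius j) t (H (p / 2) (D y)) := fun y =>
      mul_nonneg (hw.nonneg y) (regPow_nonneg (molRadius_pos j) _)
    calc ∫⁻ y in Ω', ENNReal.ofReal (q j y)
        ≤ ∫⁻ y in Ω', ENNReal.ofReal (η y ^ 2 * regPow (molRadius j) (γ / 2) (y - x) *
          regPow (molRadius j) t (H (p / 2) (D y))) := by
          refine setLIntegral_mono' hΩ'.measurableSet fun y hy => ENNReal.ofReal_le_ofReal ?_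
          rw [hη1 y (subset_closure hy), one_pow, one_mul, mul_comm]
      _ ≤ ∫⁻ y, ENNReal.ofReal (η y ^ 2 * regPow (molRadius j) (γ / 2) (y - x) *
          regPow (molRadius j) t (H (p / 2) (D y))) := setLIntegral_le_lintegral _ _
      _ = ENNReal.ofReal (∫ y, η y ^ 2 * regPow (molRadius j) (γ / 2) (y - x) *
          regPow (molRadius j) t (H (p / 2) (D y))) :=
          (ofReal_integral_eq_lintegral_ofReal hint (Eventually.of_forall h0)).symm
      _ ≤ _ := ENNReal.ofReal_le_ofReal (hle.trans (le_max_right _ _))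
  have hlim : ∀ y, Tendsto (fun j => ENNReal.ofReal (q j y)) atTop
      (𝓝 (ENNReal.ofReal (‖D y‖ - 1) ^ (-(p * t)) * ENNReal.ofReal ‖x - y‖ ^ (-γ))) := by
    intro y
    have h1 := tendsto_ofReal_regPow t (H (p / 2) (D y))
    have h2 := tendsto_ofReal_regPow (γ / 2) (y - x)
    rw [ofReal_norm_H_sq_rpow hp] at h1
    rw [ofReal_norm_sq_rpow, norm_sub_rev] at h2
    -- Both limits are nonzero because the exponents are nonpositive, which excludes the
    -- discontinuity of the product at 0 · ∞.
    refine (ENNReal.Tendsto.mul h1 (Or.inl (rpow_neg_ofReal_ne_zero (by positivity))) h2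
      (Or.inl (rpow_neg_ofReal_ne_zero hγ))).congr fun j => ?_
    rw [hq, ENNReal.ofReal_mul (regPow_nonneg (molRadius_pos j) _)]
  calc _ = ∫⁻ y in Ω', liminf (fun j => ENNReal.ofReal (q j y)) atTop := by
        congr 1; ext y
        exact (hlim y).liminf_eq.symm
    _ ≤ liminf (fun j => ∫⁻ y in Ω', ENNReal.ofReal (q j y)) atTop :=
        lintegral_liminf_le fun j => (hqm j).ennreal_ofReal
    _ ≤ _ := liminf_le_of_frequently_le' (Frequently.of_forall hbd)

lemma lintegral_weight_congr {Ω' W : Set (Sp n)} (hΩ' : IsOpen Ω') (hΩ'W : Ω' ⊆ W)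
    {D Du : Sp n → Sp n} (hD : ∀ᵐ x, x ∈ W → D x = Du x) (a γ : ℝ) (x : Sp n) :
    ∫⁻ y in Ω', ENNReal.ofReal (‖Du y‖ - 1) ^ a * ENNReal.ofReal ‖x - y‖ ^ (-γ) =
      ∫⁻ y in Ω', ENNReal.ofReal (‖D y‖ - 1) ^ a * ENNReal.ofReal ‖x - y‖ ^ (-γ) := by
  refine setLIntegral_congr_fun_ae hΩ'.measurableSet ?_
  filter_upwards [hD] with y hy hyΩ
  rw [hy (hΩ'W hyΩ)]

theorem exists_bound_supWeightIntegral (hn : 2 ≤ n) {Ω Ω' W : Set (Sp n)} (hΩ' : IsOpen Ω')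
    (hW : IsOpen W) (hΩ'W : CompactlyIn Ω' W) (hWΩ : CompactlyIn W Ω) {p t γ K L M c₁ : ℝ}
    (hp : 2 ≤ p) (ht : t ∈ Icc (0 : ℝ) ((p - 2) / p))
    (hγ : (n = 2 ∧ γ = 0) ∨ (2 < n ∧ γ < (n : ℝ) - 2))
    (hγΩ : 0 ≤ γ ∨ Bornology.IsBounded Ω)
    (hL : 0 ≤ L) (hM : 0 ≤ M) (hc₁ : 0 < c₁) :
    ∃ C : ℝ, 0 < C ∧ ∀ (u : Sp n → ℝ) (D Du : Sp n → Sp n) (F : Sp n → ℝ),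
      BoundedSolution W p K L M u D F → (∀ᵐ x, x ∈ W → c₁ ≤ F x) →
      (∀ᵐ x, x ∈ W → D x = Du x) → supWeightIntegral Ω Ω' p t γ Du ≤ ENNReal.ofReal C := by
  have hn2 : (2 : ℝ) ≤ n := by exact_mod_cast hn
  rcases le_or_gt 0 γ with h0 | h0
  · have hγ2 : γ = 0 ∨ γ + 2 < n := hγ.imp (fun h => h.2) fun h => by linarith [h.2]
    have hγn : γ < n := by rcases hγ2 with h | h <;> linarith
    obtain ⟨C, hC, h⟩ := exists_bound_weight_integral (K := K) hn hΩ' hW hΩ'W hp ht.1 ht.2 h0 hγn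
      hγ2 hL hM hc₁
    refine ⟨C, hC, fun u D Du F hs hF hD => iSup₂_le fun x _ => ?_⟩
    rw [lintegral_weight_congr hΩ' hΩ'W.subset hD]
    exact h u D F hs hF x
  -- For γ < 0 the kernel is bounded by a power of the diameter of Ω, which reduces the claim to γ =
  -- 0; the added 1 keeps d positive.
  · have hb := hγΩ.resolve_left (not_le.2 h0)
    obtain ⟨C, hC, h⟩ := exists_bound_weight_integral (K := K) hn hΩ' hW hΩ'W hp ht.1 ht.2 le_rfl
      (by linarith) (Or.inl rfl) hL hM hc₁
    set d := Metric.diam Ω + 1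
    have hd : 0 < d := by have := Metric.diam_nonneg (s := Ω); positivity
    refine ⟨C * d ^ (-γ), by positivity, fun u D Du F hs hF hD => iSup₂_le fun x hx => ?_⟩
    rw [lintegral_weight_congr hΩ' hΩ'W.subset hD]
    have h1 := h u D F hs hF x
    simp only [neg_zero, ENNReal.rpow_zero, mul_one] at h1
    rw [ENNReal.ofReal_mul hC.le]
    have hpt : ∀ y ∈ Ω', ENNReal.ofReal (‖D y‖ - 1) ^ (-(p * t)) *
        ENNReal.ofReal ‖x - y‖ ^ (-γ) ≤
        ENNReal.ofReal (‖D y‖ - 1) ^ (-(p * t)) * ENNReal.ofReal (d ^ (-γ)) := by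
      intro y hy
      gcongr
      rw [← ENNReal.ofReal_rpow_of_nonneg hd.le (by linarith)]
      refine ENNReal.rpow_le_rpow (ENNReal.ofReal_le_ofReal ?_) (by linarith)
      rw [← dist_eq_norm]
      have := Metric.dist_le_diam_of_mem hb hx (hWΩ.subset (hΩ'W.subset hy))
      linarith
    refine (setLIntegral_mono' hΩ'.measurableSet hpt).trans ?_
    rw [lintegral_mul_const' _ _ ENNReal.ofReal_ne_top]
    gcongr

theorem volume_degenerate_eq_zero (hn : 2 ≤ n) {Ω' W : Set (Sp n)}
    (hW : IsOpen W) (hΩ'W : CompactlyIn Ω' W) {p K L M c₁ : ℝ} (hp : 2 ≤ p)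
    (hL : 0 ≤ L) (hM : 0 ≤ M) (hc₁ : 0 < c₁) {u : Sp n → ℝ} {D Du : Sp n → Sp n} {F : Sp n → ℝ}
    (hs : BoundedSolution W p K L M u D F) (hF : ∀ᵐ x, x ∈ W → c₁ ≤ F x)
    (hD : ∀ᵐ x, x ∈ W → D x = Du x) : volume {x ∈ Ω' | ‖Du x‖ ≤ 1} = 0 := by
  have : NeZero n := ⟨by omega⟩
  obtain ⟨η, hη, hηc, hηW, hη1, hη01⟩ := exists_cutoff hΩ'W.1 hW hΩ'W.2
  obtain ⟨r, hr, hrW⟩ := exists_compact_margin hηc hW hηW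
  obtain ⟨E, hE⟩ := (hηc.fderiv ℝ).exists_bound_of_continuous (hη.continuous_fderiv (by simp))
  -- With γ = 0 the kernel is identically 1, so this weight is simply η².
  have hw := admissibleWeight_singular hη hηc hη01 hE le_rfl
    (by exact_mod_cast (by omega : 0 < n)) (Or.inl rfl) one_pos 0
  have hsupp : tsupport (fun y => η y ^ 2 * regPow 1 ((0 : ℝ) / 2) (y - 0)) ⊆ tsupport η := by
    exact closure_mono fun y hy hy' => hy (by simp [show η y = 0 from hy'])
  have hle := hs.integral_weight_degenerate_le hp hL hM hw hsupp hrW hr hc₁ hF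
  set ζ : Sp n → ℝ := fun y => η y ^ 2 * regPow 1 ((0 : ℝ) / 2) (y - 0) with hζ
  have h0 : ∀ x, 0 ≤ ζ x * (if H (p / 2) (D x) = 0 then 1 else 0) := fun x =>
    mul_nonneg (hw.nonneg x) (by split_ifs <;> norm_num)
  have hm : Measurable fun x => (if H (p / 2) (D x) = 0 then 1 else 0 : ℝ) :=
    Measurable.ite (hs.measurable_H_comp (p / 2) (measurableSet_singleton 0)) measurable_const
      measurable_const
  have hint : Integrable fun x => ζ x * (if H (p / 2) (D x) = 0 then 1 else 0) :=
    hw.integrable.mul_bdd (c := 1) hm.aestronglyMeasurable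
      (Eventually.of_forall fun x => by split_ifs <;> simp)
  have hz := (integral_eq_zero_iff_of_nonneg h0 hint).1 (le_antisymm hle (integral_nonneg h0))
  have hne : ∀ᵐ x, ¬ (x ∈ Ω' ∧ ‖Du x‖ ≤ 1) := by
    filter_upwards [hz, hD] with x hx hDx
    rintro ⟨hxΩ, hle1⟩
    have hH : H (p / 2) (D x) = 0 := by
      rw [hDx (hΩ'W.subset hxΩ), ← norm_eq_zero, norm_H (by linarith),
        max_eq_right (by linarith), Real.zero_rpow (by linarith)]
    simp [hζ, hH, hη1 x (subset_closure hxΩ), regPow] at hx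
  simpa [ae_iff] using hne

end WeightIntegral

end WidelyDegenerate
end

/-! ### The main theorem -/

theorem mainTheorem2 {n : ℕ} (hn : 2 ≤ n) (Ω : Set (WidelyDegenerate.Sp n)) (hΩ : IsOpen Ω)
    (p : ℝ) (hp : 2 ≤ p) (γ : ℝ) (hγ : (n = 2 ∧ γ = 0) ∨ (2 < n ∧ γ < (n : ℝ) - 2))
    (hγΩ : 0 ≤ γ ∨ Bornology.IsBounded Ω)
    (t : ℝ) (ht : t ∈ Set.Icc (0 : ℝ) ((p - 2) / p))
    (Ω' : Set (WidelyDegenerate.Sp n)) (hΩ' : IsOpen Ω')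
    (hΩ'Ω : WidelyDegenerate.CompactlyIn Ω' Ω) :
    -- the bound for a fixed `f`: the constant depends on `u` only through its norm
    (∀ f : WidelyDegenerate.Sp n → ℝ → ℝ, WidelyDegenerate.IsPositiveOn f Ω →
      WidelyDegenerate.SatisfiesF1F2 f Ω →
      ∀ Ω'' : Set (WidelyDegenerate.Sp n), IsOpen Ω'' → WidelyDegenerate.CompactlyIn Ω' Ω'' →
      WidelyDegenerate.CompactlyIn Ω'' Ω → ∀ K : ℝ, 0 < K →
      ∃ C : ℝ, 0 < C ∧ ∀ (u : WidelyDegenerate.Sp n → ℝ)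
        (Du : WidelyDegenerate.Sp n → WidelyDegenerate.Sp n),
        WidelyDegenerate.MemW1loc Ω ⊤ u Du →
        WidelyDegenerate.IsLocalWeakSolution Ω p f u Du →
        WidelyDegenerate.normW1inf Ω'' u Du ≤ ENNReal.ofReal K →
        WidelyDegenerate.supWeightIntegral Ω Ω' p t γ Du ≤ ENNReal.ofReal C) ∧
    -- the bound uniformly in `f`: the constant depends on `f` only through `L`, `M`, `c₁`
    (∀ Ω'' : Set (WidelyDegenerate.Sp n), IsOpen Ω'' → WidelyDegenerate.CompactlyIn Ω' Ω'' →
      WidelyDegenerate.CompactlyIn Ω'' Ω → ∀ K L M c₁ : ℝ, 0 < K → 0 < L → 0 < M → 0 < c₁ →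
      ∃ C : ℝ, 0 < C ∧ ∀ f : WidelyDegenerate.Sp n → ℝ → ℝ,
        WidelyDegenerate.IsPositiveOn f Ω → WidelyDegenerate.SatisfiesF1F2 f Ω →
        WidelyDegenerate.LipBounds f Ω'' K L M →
        ∀ (u : WidelyDegenerate.Sp n → ℝ) (Du : WidelyDegenerate.Sp n → WidelyDegenerate.Sp n),
        WidelyDegenerate.MemW1loc Ω ⊤ u Du →
        WidelyDegenerate.IsLocalWeakSolution Ω p f u Du →
        WidelyDegenerate.normW1inf Ω'' u Du ≤ ENNReal.ofReal K →
        (∀ᵐ y ∂(MeasureTheory.volume.restrict Ω''), c₁ ≤ f y (u y)) →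
        WidelyDegenerate.supWeightIntegral Ω Ω' p t γ Du ≤ ENNReal.ofReal C) ∧
    -- the degeneracy set is null
    (∀ f : WidelyDegenerate.Sp n → ℝ → ℝ, WidelyDegenerate.IsPositiveOn f Ω →
      WidelyDegenerate.SatisfiesF1F2 f Ω →
      ∀ (u : WidelyDegenerate.Sp n → ℝ) (Du : WidelyDegenerate.Sp n → WidelyDegenerate.Sp n),
        WidelyDegenerate.MemW1loc Ω ⊤ u Du →
        WidelyDegenerate.IsLocalWeakSolution Ω p f u Du →
        MeasureTheory.volume {x ∈ Ω' | ‖Du x‖ ≤ 1} = 0) := by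
  have hmain : ∀ Ω'' : Set (WidelyDegenerate.Sp n), IsOpen Ω'' →
      WidelyDegenerate.CompactlyIn Ω' Ω'' → WidelyDegenerate.CompactlyIn Ω'' Ω →
      ∀ K L M c₁ : ℝ, 0 < K → 0 < L → 0 < M → 0 < c₁ →
      ∃ C : ℝ, 0 < C ∧ ∀ f : WidelyDegenerate.Sp n → ℝ → ℝ,
        WidelyDegenerate.LipBounds f Ω'' K L M →
        ∀ (u : WidelyDegenerate.Sp n → ℝ) (Du : WidelyDegenerate.Sp n → WidelyDegenerate.Sp n),
        WidelyDegenerate.MemW1loc Ω ⊤ u Du →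
        WidelyDegenerate.IsLocalWeakSolution Ω p f u Du →
        WidelyDegenerate.normW1inf Ω'' u Du ≤ ENNReal.ofReal K →
        (∀ᵐ y, y ∈ Ω'' → c₁ ≤ f y (u y)) →
        WidelyDegenerate.supWeightIntegral Ω Ω' p t γ Du ≤ ENNReal.ofReal C := by
    intro W hW hΩ'W hWΩ K L M c₁ hK hL hM hc₁
    obtain ⟨C, hC, h⟩ := WidelyDegenerate.exists_bound_supWeightIntegral (K := K) hn hΩ' hW hΩ'W hWΩ
      hp ht hγ hγΩ hL.le hM.le hc₁
    refine ⟨C, hC, fun f hf u Du hu hsol hKu hF => ?_⟩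
    obtain ⟨u₀, D, hs, -, hD⟩ := WidelyDegenerate.exists_boundedSolution hW hWΩ hK hf hu hsol hKu
    exact h u₀ D Du _ hs hF hD
  refine ⟨fun f hpos hf W hW hΩ'W hWΩ K hK => ?_, fun W hW hΩ'W hWΩ K L M c₁ hK hL hM hc₁ => ?_,
    fun f hpos hf u Du hu hsol => ?_⟩
  -- For fixed f the constants L, M and c₁ are determined by Ω'' and K alone, before u is
  -- introduced.
  · obtain ⟨L, M, hL, hM, hLM⟩ := hf W hW hWΩ K hK
    obtain ⟨c₁, hc₁, hlow⟩ := WidelyDegenerate.exists_pos_lower_bound hΩ hWΩ hpos hf hK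
    obtain ⟨C, hC, h⟩ := hmain W hW hΩ'W hWΩ K L M c₁ hK hL hM hc₁
    refine ⟨C, hC, fun u Du hu hsol hKu => h f hLM u Du hu hsol hKu ?_⟩
    obtain ⟨u₀, D, hs, hu₀, -⟩ :=
      WidelyDegenerate.exists_boundedSolution hW hWΩ hK hLM hu hsol hKu
    exact WidelyDegenerate.ae_le_rhs hs hu₀ hlow
  · obtain ⟨C, hC, h⟩ := hmain W hW hΩ'W hWΩ K L M c₁ hK hL hM hc₁
    refine ⟨C, hC, fun f _ _ hLM u Du hu hsol hKu hF => h f hLM u Du hu hsol hKu ?_⟩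
    exact (MeasureTheory.ae_restrict_iff' hW.measurableSet).1 hF
  -- No intermediate set is prescribed here, so one is inserted; K is the norm of u on it, increased
  -- by 1 to be positive.
  · obtain ⟨W, hW, hWΩ, hΩ'W⟩ :=
      WidelyDegenerate.exists_compactlyIn_between hΩ'Ω.1 hΩ hΩ'Ω.2
    obtain ⟨hm1, hm2⟩ := hu.2 W hW hWΩ
    have hfin : WidelyDegenerate.normW1inf W u Du ≠ ⊤ :=
      ENNReal.add_ne_top.2 ⟨hm1.2.ne, hm2.2.ne⟩
    set K := (WidelyDegenerate.normW1inf W u Du).toReal + 1 with hKdef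
    have hK : 0 < K := by positivity
    have hKu : WidelyDegenerate.normW1inf W u Du ≤ ENNReal.ofReal K :=
      (ENNReal.le_ofReal_iff_toReal_le hfin hK.le).2 (by linarith)
    obtain ⟨L, M, hL, hM, hLM⟩ := hf W hW hWΩ K hK
    obtain ⟨c₁, hc₁, hlow⟩ := WidelyDegenerate.exists_pos_lower_bound hΩ hWΩ hpos hf hK
    obtain ⟨u₀, D, hs, hu₀, hD⟩ :=
      WidelyDegenerate.exists_boundedSolution hW hWΩ hK hLM hu hsol hKu
    exact WidelyDegenerate.volume_degenerate_eq_zero hn hW ⟨hΩ'Ω.1, hΩ'W⟩ hp hL.le hM.le hc₁ hs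
      (WidelyDegenerate.ae_le_rhs hs hu₀ hlow) hD
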